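/- A Lax $\mu$Graph is a hierarchical (kernel / block / thread level) tensor computation graph built from multilinear operators with integer coefficients, elementwise addition, elementwise division and elementwise exponentiation (and from graph-defined operators with input iterators, for-loop bodies, sum or concatenation accumulators and output savers), in which every path from an input to an output contains at most one exponentiation. Over $\mathbb R$ its output entries are partial functions of the input entries (undefined where a division by zero occurs); two $\mu$Graphs are equivalent if every output entry agrees at all real inputs where both are defined. Let $p,q$ be primes with $q\mid p-1$. A random test draws, independently and uniformly, each input entry $(u,v)\in\mathbb Z_p\times\mathbb Z_q$ and a $q$-th root of unity $\omega\in\mathbb Z_p$. It evaluates both $\mu$Graphs on pairs $(x_p,x_q)$: all operations except exponentiation act componentwise, division by $0$ is undefined, and $\exp(x_p,x_q)=(\omega^{x_q},-)$. It compares the $\mathbb Z_p$-components of the outputs. The test is passed if no output entry gets two different values; it is admissible if all output entries of both $\mu$Graphs are defined. 1. If two $\mu$Graphs built from these operators are equivalent, they pass every test, for all such $p$ and $q$ (hence any number of tests, with certainty). 2. The difference of two Lax $\mu$Graphs at each output entry is, as a real function, of the form $$\frac{\sum_{i=1}^{k} f_i\exp(g_i/h_i)}{\sum_{j=1}^{k'}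 f'_j\exp(g'_j/h'_j)}\qquad(*)$$ with polynomials $f_i,g_i,h_i,f'_j,g'_j,h'_j$ with integer coefficients in the input entries, where the $h_i$, the $h'_j$ and the denominator are not identically zero. 3. There is an absolute constant $C>0$ such that for all $k,d,w\in\mathbb N$ there is $q_0$ with the following property. Let $G_1,G_2$ be non-equivalent Lax $\mu$Graphs, and suppose that at an output entry where they are not equivalent, their difference has a form $(*)$ with $k$ terms in the numerator and polynomials of degree at most $d$ with coefficients in $[-w,w]$. Let $0<\delta\le 1$ and let $T$ be an integer with $$T\ \ge\ C\,\frac{k^2}{\ln q}\,\ln\frac1\delta .$$ (a) For all primes $p$, $q\ge q_0$ with $q\mid p-1$, the probability that $T$ independent random tests are all admissible and all passed (that is, both $\mu$Graphs can be evaluated and give identical outputs every time) is at most $\delta$. (b) Suppose that each of $G_1$, $G_2$ has all its output entries defined at some real input. Then there is $q_1$ (depending on $G_1,G_2$ and the form $(*)$) such that for all primes $p$, $q\ge q_1$ with $q\mid p-1$ admissible samples exist, and the probability that $T$ independent tests, each uniformly distributed on the admissible samples (inadmissible samples are redrawn), are all passed is at most $\delta$. -/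

import Mathlib

noncomputable section

namespace MuGraph

/-! ### Tensors -/

/-- The shape of a tensor: the list of its dimensions. -/
abbrev Shape := List ℕ

/-- The positions of a tensor of shape `s`. -/
abbrev Idx (s : Shape) := (i : Fin s.length) → Fin (s.get i)

/-- Tensors of shape `s` with entries in `V`. -/
abbrev Tensor (V : Type) (s : Shape) := Idx s → V

/-- A tensor of shape `s` occurring in the list of tensors `Γ`. -/
inductive Var : List Shape → Shape → Type
  | zero {Γ : List Shape} {s : Shape} : Var (s :: Γ) s
  | succ {Γ : List Shape} {s t : Shape} : Var Γ s → Var (t :: Γ) s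

/-- The `i`-th tensor of the list `Γ`. -/
def Var.get : (Γ : List Shape) → (i : Fin Γ.length) → Var Γ (Γ.get i)
  | _ :: _, ⟨0, _⟩ => .zero
  | _ :: Γ, ⟨i + 1, h⟩ => .succ (Var.get Γ ⟨i, Nat.lt_of_succ_lt_succ h⟩)

/-- All scalar entries of a list of tensors. -/
abbrev Entry (Γ : List Shape) := (i : Fin Γ.length) × Idx (Γ.get i)

/-- The position, among all entries of `Γ`, of an entry of one of its tensors. -/
def Var.entry {Γ : List Shape} {s : Shape} : Var Γ s → Idx s → Entry Γ
  | .zero, j => ⟨⟨0, Nat.succ_pos _⟩, j⟩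
  | .succ v, j => ⟨(v.entry j).1.succ, (v.entry j).2⟩

/-- A family of objects, one for each tensor in the list `Γ`. -/
abbrev Assign (A : Shape → Type) (Γ : List Shape) := ∀ ⦃s : Shape⦄, Var Γ s → A s

/-- Extend a family by one object. -/
def Assign.push {A : Shape → Type} {Γ : List Shape} {t : Shape} (a : A t) (f : Assign A Γ) :
    Assign A (t :: Γ)
  | _, .zero => a
  | _, .succ v => f v

/-- Concatenation of two families. -/
def Assign.append {A : Shape → Type} {Γ : List Shape} :
    (Δ : List Shape) → Assign A Δ → Assign A Γ → Assign A (Δ ++ Γ)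
  | [], _, f => f
  | _ :: Δ, g, f => Assign.push (g .zero) (Assign.append Δ (fun _ v => g (.succ v)) f)

/-- A value for every tensor in `Γ`. -/
abbrev Env (V : Type) (Γ : List Shape) := Assign (Tensor V) Γ

/-! ### μGraphs -/

/-- The multilinear operators with input shapes `ins` and output shape `out`. They have integer
coefficients, so that they can be evaluated over the reals and over every finite field. -/
abbrev MultilinearOp (ins : List Shape) (out : Shape) :=
  MultilinearMap ℤ (fun i : Fin ins.length => Tensor ℤ (ins.get i)) (Tensor ℤ out)

/-- The coefficient with which the product of the input entries at the positions `idx` enters the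
output entry at position `o`. -/
def MultilinearOp.coeff {ins : List Shape} {out : Shape} (f : MultilinearOp ins out)
    (o : Idx out) (idx : (i : Fin ins.length) → Idx (ins.get i)) : ℤ :=
  f (fun i => Pi.single (idx i) 1) o

/-- Pre-defined operators: multilinear operators (matrix multiplication, elementwise product,
convolution, reduction, reshaping, repetition, ...), elementwise addition, elementwise division,
and elementwise exponentiation. -/
inductive PrimOp : List Shape → Shape → Type
  | multilinear {ins : List Shape} {out : Shape} (f : MultilinearOp ins out) : PrimOp ins out
  | add (s : Shape) : PrimOp [s, s] s
  | div (s : Shape) : PrimOp [s, s] s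
  | exp (s : Shape) : PrimOp [s] s

/-- An input iterator of a graph-defined operator: in each block (of the grid `grid`) and each
iteration (of the for-loop `loops`) it loads a tensor of shape `s` from the source tensor `src`.
All index maps are allowed, in particular those given by an imap and an fmap
(partition along a data dimension, or replication). -/
structure InputIter (Γ : List Shape) (grid loops s : Shape) where
  srcShape : Shape
  src : Var Γ srcShape
  map : Idx grid → Idx loops → Idx s → Idx srcShape

/-- A for-loop accumulator: the results of all iterations are either summed up, or
concatenated to a larger tensor. -/
inductive Accum (loops : Shape) : Shape → Shape → Type
  | sum (s : Shape) : Accum loops s s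
  | concat {s t : Shape} (e : Idx loops × Idx s ≃ Idx t) : Accum loops s t

/-- The tensor that a for-loop accumulator of output shape `t` accumulates. -/
structure Accumulator (Γ : List Shape) (loops t : Shape) where
  srcShape : Shape
  src : Var Γ srcShape
  kind : Accum loops srcShape t

/-- An output saver: the results of all blocks are concatenated to a tensor of shape `t`,
as prescribed for instance by an omap. -/
structure OutputSaver (Γ : List Shape) (grid t : Shape) where
  srcShape : Shape
  src : Var Γ srcShape
  map : Idx grid × Idx srcShape ≃ Idx t

/-- Computation graphs of a given level with input tensors `Γ` and output tensors `Δ`, as sequences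
of operators in topological order; each operator adds its outputs to the available tensors.
* `ret`: choose the output tensors of the graph among the available tensors.
* `prim`: apply a pre-defined operator.
* `call`: apply a graph-defined operator, given by a graph of the next lower level. The graph
  is run for every index of `grid`. It consists of input iterators, a for-loop body that is executed
  for every index of `loops`, for-loop accumulators, operators applied after the loop, and
  output savers. -/
inductive Graph : ℕ → List Shape → List Shape → Type
  | ret {l : ℕ} {Γ Δ : List Shape} (outs : Assign (Var Γ) Δ) : Graph l Γ Δ
  | prim {l : ℕ} {Γ Δ ins : List Shape} {out : Shape} (op : PrimOp ins out)
      (args : Assign (Var Γ) ins) (rest : Graph l (out :: Γ) Δ) : Graph l Γ Δ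
  | call {l : ℕ} {Γ Δ loc res acc fin outs : List Shape} (grid loops : Shape)
      (iters : Assign (InputIter Γ grid loops) loc)
      (body : Graph l loc res)
      (accums : Assign (Accumulator res loops) acc)
      (post : Graph l acc fin)
      (savers : Assign (OutputSaver fin grid) outs)
      (rest : Graph (l + 1) (outs ++ Γ) Δ) : Graph (l + 1) Γ Δ

/-- A μGraph: a kernel graph (level 2), whose graph-defined operators are given by block graphs
(level 1), whose graph-defined operators are given by thread graphs (level 0). -/
abbrev _root_.MuGraph (Γ Δ : List Shape) := Graph 2 Γ Δ

/-! ### Evaluation -/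

/-- An interpretation of the operators on a domain `V` of scalar values. -/
structure Interp (V : Type) where
  multilinear {ins : List Shape} {out : Shape} (f : MultilinearOp ins out) :
    ((i : Fin ins.length) → Tensor V (ins.get i)) → Tensor V out
  sum {ι : Type} [Fintype ι] (x : ι → V) : V
  div : V → V → V
  exp : V → V

/-- The output tensor of a pre-defined operator. -/
def PrimOp.eval {V : Type} (I : Interp V) {ins : List Shape} {out : Shape} :
    PrimOp ins out → Env V ins → Tensor V out
  | .multilinear f, X => I.multilinear f (fun i => X (Var.get _ i))
  | .add _, X => fun j => I.sum ![X .zero j, X (.succ .zero) j]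
  | .div _, X => fun j => I.div (X .zero j) (X (.succ .zero) j)
  | .exp _, X => fun j => I.exp (X .zero j)

/-- The accumulated tensor. -/
def Accum.eval {V : Type} (I : Interp V) {loops s t : Shape} :
    Accum loops s t → (Idx loops → Tensor V s) → Tensor V t
  | .sum _, X => fun j => I.sum (fun r => X r j)
  | .concat e, X => fun j => X (e.symm j).1 (e.symm j).2

/-- The output tensors of a graph. -/
def Graph.eval {V : Type} (I : Interp V) {l : ℕ} {Γ Δ : List Shape} :
    Graph l Γ Δ → Env V Γ → Env V Δ
  | .ret outs, X => fun _ v => X (outs v)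
  | .prim op args rest, X =>
      rest.eval I (Assign.push (op.eval I (fun _ v => X (args v))) X)
  | .call (outs := outs) _ _ iters body accums post savers rest, X =>
      rest.eval I (Assign.append outs (fun _ v j =>
        let b := ((savers v).map.symm j).1
        post.eval I
          (fun _ a => (accums a).kind.eval I (fun r =>
            body.eval I (fun _ c i => X (iters c).src ((iters c).map b r i)) (accums a).src))
          (savers v).src ((savers v).map.symm j).2) X)

/-- The output entries of a μGraph as functions of its input entries. -/
def Graph.run {V : Type} (I : Interp V) {l : ℕ} {Γ Δ : List Shape} (G : Graph l Γ Δ)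
    (x : Entry Γ → V) (e : Entry Δ) : V :=
  G.eval I (fun _ v j => x (v.entry j)) (Var.get Δ e.1) e.2

open Classical in
/-- A multilinear operator on partially defined tensors over a commutative ring: an output
entry is defined if all input entries on which it depends are. -/
def multilinearOpt {F : Type} [CommRing F] {ins : List Shape} {out : Shape}
    (f : MultilinearOp ins out) (X : (i : Fin ins.length) → Tensor (Option F) (ins.get i)) :
    Tensor (Option F) out := fun o =>
  if ∀ idx, f.coeff o idx ≠ 0 → ∀ i, (X i (idx i)).isSome then
    some (∑ idx, (f.coeff o idx : F) * ∏ i, (X i (idx i)).getD 0)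
  else none

open Classical in
/-- Sum of partially defined scalars. -/
def sumOpt {F : Type} [CommRing F] {ι : Type} [Fintype ι] (x : ι → Option F) : Option F :=
  if ∀ i, (x i).isSome then some (∑ i, (x i).getD 0) else none

open Classical in
/-- Division of partially defined scalars; division by zero is undefined. -/
def divOpt {F : Type} [Field F] (x y : Option F) : Option F :=
  x.bind fun a => y.bind fun b => if b = 0 then none else some (a / b)

/-- Evaluation over the real numbers. -/
def realInterp : Interp (Option ℝ) where
  multilinear f X := multilinearOpt f X
  sum x := sumOpt x
  div := divOpt
  exp x := x.map Real.exp

/-- Evaluation over the finite fields `ℤ/p` (outside of exponents) and `ℤ/q` (inside of exponents),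
with `ω` in place of the base of the exponential. A value is a pair of a component in
`ℤ/p` and a component in `ℤ/q`; all operations except exponentiation act on the two
components independently, and the result of an exponentiation has no second component. -/
def finiteInterp (p q : ℕ) [Fact p.Prime] [Fact q.Prime] (ω : ZMod p) :
    Interp (Option (ZMod p) × Option (ZMod q)) where
  multilinear f X := fun o =>
    (multilinearOpt f (fun i j => (X i j).1) o, multilinearOpt f (fun i j => (X i j).2) o)
  sum x := (sumOpt (fun i => (x i).1), sumOpt (fun i => (x i).2))
  div x y := (divOpt x.1 y.1, divOpt x.2 y.2)
  exp x := (x.2.map (fun a => ω ^ a.val), none)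

/-- The value of an output entry at a real input, if no division by zero occurs. -/
def Graph.realRun {l : ℕ} {Γ Δ : List Shape} (G : Graph l Γ Δ) (x : Entry Γ → ℝ)
    (e : Entry Δ) : Option ℝ :=
  G.run realInterp (fun i => some (x i)) e

/-! ### Lax μGraphs -/

/-- The number of exponentiations that an operator performs on a path through it. -/
def PrimOp.expCount {ins : List Shape} {out : Shape} : PrimOp ins out → ℕ
  | .exp _ => 1
  | _ => 0

/-- For each output of a graph, the largest number of exponentiations on a path that ends there,
if `n` gives these numbers for its inputs. -/
def Graph.expDepth {l : ℕ} {Γ Δ : List Shape} :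
    Graph l Γ Δ → Assign (fun _ => ℕ) Γ → Assign (fun _ => ℕ) Δ
  | .ret outs, n => fun _ v => n (outs v)
  | .prim (ins := ins) op args rest, n =>
      rest.expDepth (Assign.push
        ((Finset.univ.sup fun i : Fin ins.length => @n (ins.get i) (args (Var.get ins i))) + op.expCount) n)
  | .call (outs := outs) _ _ iters body accums post savers rest, n =>
      rest.expDepth (Assign.append outs (fun _ v =>
        post.expDepth (fun _ a =>
          body.expDepth (fun _ c => n (iters c).src) (accums a).src) (savers v).src) n)

/-- Every path from an input to an output contains at most one exponentiation. -/
def Graph.IsLax {l : ℕ} {Γ Δ : List Shape} (G : Graph l Γ Δ) : Prop :=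
  ∀ (s : Shape) (v : Var Δ s), G.expDepth (fun _ _ => 0) v ≤ 1

/-! ### Equivalence and the normal form -/

/-- Two μGraphs compute the same real function at an output entry: they agree wherever both are
defined. -/
def EquivalentAt {Γ Δ : List Shape} (G₁ G₂ : MuGraph Γ Δ) (e : Entry Δ) : Prop :=
  ∀ (x : Entry Γ → ℝ) (a b : ℝ), G₁.realRun x e = some a → G₂.realRun x e = some b → a = b

/-- Equivalent μGraphs. -/
def Equivalent {Γ Δ : List Shape} (G₁ G₂ : MuGraph Γ Δ) : Prop :=
  ∀ e : Entry Δ, EquivalentAt G₁ G₂ e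

/-- Expressions `(∑ i < k, f i * exp (g i / h i)) / (∑ j < k', f' j * exp (g' j / h' j))`, where
`f`, `g`, `h`, `f'`, `g'`, `h'` are polynomials with integer coefficients. -/
structure LaxForm (σ : Type) (k k' : ℕ) where
  f : Fin k → MvPolynomial σ ℤ
  g : Fin k → MvPolynomial σ ℤ
  h : Fin k → MvPolynomial σ ℤ
  f' : Fin k' → MvPolynomial σ ℤ
  g' : Fin k' → MvPolynomial σ ℤ
  h' : Fin k' → MvPolynomial σ ℤ

namespace LaxForm

variable {σ : Type} {k k' : ℕ}

/-- The real numerator. -/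
def num (P : LaxForm σ k k') (x : σ → ℝ) : ℝ :=
  ∑ i, MvPolynomial.aeval x (P.f i) *
    Real.exp (MvPolynomial.aeval x (P.g i) / MvPolynomial.aeval x (P.h i))

/-- The real denominator. -/
def den (P : LaxForm σ k k') (x : σ → ℝ) : ℝ :=
  ∑ j, MvPolynomial.aeval x (P.f' j) *
    Real.exp (MvPolynomial.aeval x (P.g' j) / MvPolynomial.aeval x (P.h' j))

/-- No division by zero occurs at `x`. -/
def DefinedAt (P : LaxForm σ k k') (x : σ → ℝ) : Prop :=
  (∀ i, MvPolynomial.aeval x (P.h i) ≠ 0) ∧ (∀ j, MvPolynomial.aeval x (P.h' j) ≠ 0) ∧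
    P.den x ≠ 0

/-- All polynomials have degree at most `d` and coefficients in `[-w, w]`. -/
def Bounded (P : LaxForm σ k k') (d w : ℕ) : Prop :=
  (∀ i, ∀ r ∈ ({P.f i, P.g i, P.h i} : Set (MvPolynomial σ ℤ)),
    r.totalDegree ≤ d ∧ ∀ m, |r.coeff m| ≤ w) ∧
  (∀ j, ∀ r ∈ ({P.f' j, P.g' j, P.h' j} : Set (MvPolynomial σ ℤ)),
    r.totalDegree ≤ d ∧ ∀ m, |r.coeff m| ≤ w)

end LaxForm

/-- The expression `P` is meaningful somewhere, and it is the difference of the two μGraphs at the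
output entry `e`, as a real function. -/
def IsDifference {Γ Δ : List Shape} (G₁ G₂ : MuGraph Γ Δ) (e : Entry Δ) {k k' : ℕ}
    (P : LaxForm (Entry Γ) k k') : Prop :=
  (∃ x, P.DefinedAt x) ∧
  ∀ (x : Entry Γ → ℝ) (a b : ℝ), P.DefinedAt x →
    G₁.realRun x e = some a → G₂.realRun x e = some b → a - b = P.num x / P.den x

/-! ### Random tests -/

/-- The random choices of a test: input tensors over `ℤ/p`, input tensors over `ℤ/q`, and a `q`-th
root of unity in `ℤ/p`. -/
abbrev Sample (p q : ℕ) (Γ : List Shape) :=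
  (Entry Γ → ZMod p) × (Entry Γ → ZMod q) × {ω : ZMod p // ω ^ q = 1}

section Tests

variable {p q : ℕ} [Fact p.Prime] [Fact q.Prime] {Γ Δ : List Shape}

/-- The result in `ℤ/p` of a μGraph on a random test, if no division by zero occurs. -/
def Graph.testRun {l : ℕ} (G : Graph l Γ Δ) (s : Sample p q Γ) (e : Entry Δ) :
    Option (ZMod p) :=
  (G.run (finiteInterp p q s.2.2) (fun i => (some (s.1 i), some (s.2.1 i))) e).1

/-- Both μGraphs can be evaluated on the sample, without a division by zero. -/
def Admissible (G₁ G₂ : MuGraph Γ Δ) (s : Sample p q Γ) : Prop :=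
  ∀ e : Entry Δ, (G₁.testRun s e).isSome ∧ (G₂.testRun s e).isSome

/-- The test does not detect a difference: no output entry has two different values. -/
def PassesTest (G₁ G₂ : MuGraph Γ Δ) (s : Sample p q Γ) : Prop :=
  ∀ (e : Entry Δ) (a b : ZMod p), G₁.testRun s e = some a → G₂.testRun s e = some b → a = b

/-- All of the tests are passed. -/
def PassesVerification (G₁ G₂ : MuGraph Γ Δ) {T : ℕ} (s : Fin T → Sample p q Γ) : Prop :=
  ∀ t, PassesTest G₁ G₂ (s t)

end Tests

/-- The probability that a uniformly random element of the finite nonempty set `S` lies in `E`. For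
`S` the set of all `T`-tuples of elements of a set, the components are independent and
uniformly distributed on this set. -/
def uniformProb {Ω : Type} (S E : Set Ω) : ℝ := ((S ∩ E).ncard : ℝ) / (S.ncard : ℝ)

end MuGraph

end

/-!
A graph is evaluated in three ways: over the real numbers, on the pairs of residues of a random
test, and formally. The formal values are elements of the field `L` of fractions of formal
expressions `∑ i, f i * exp (g i / h i)`, that is, of the monoid algebra over `ℤ[x]` whose exponents
are the elements of the field `K = ℚ(x)` of rational functions; as in a test, the result of an
exponentiation must not be used in an exponent. Two comparisons carry the proof.

* A real point or a test evaluates formal values by a place: a homomorphism from a local subring of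
  `L`, extended from the formal expressions whose exponents are defined at the point. If a graph can
  be evaluated at a point, then its formal value exists, lies in the local subring and is sent to
  the value (`Point.exists_spec`); over the real numbers this needs that the graph is Lax
  (`Graph.IsLax.exists_spec`).
* Conversely, if the formal value exists, then the graph can be evaluated at almost all points of
  any family of points at which nonzero formal expressions almost never vanish
  (`GenericPoints.eventually_pointRun`).

Two such families are used. The first one consists of the real points with rational coordinates,
up to hypersurfaces (`genericPoints_rational`): there a formal expression becomes a rational
combination of exponentials of rational numbers, so that it is enough to know that `e` is
transcendental (`transcendental_exp_one`). The second one consists of the random tests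
(`genericPoints_test`).

If two graphs are equivalent at an output entry, they agree at almost all rational points, so their
formal values coincide, and so do their values on every test (`EquivalentAt.testRun_eq`). For Lax
graphs, writing the formal difference as a fraction gives the normal form
(`exists_isDifference`), and any normal form of the difference represents the formal difference
(`IsDifference.formal_eq`).

If the graphs are not equivalent at an output entry, the numerator of the normal form is not zero
as a formal expression. If an admissible test is passed and all exponents of the numerator are
defined, then the numerator vanishes at the test; the denominator need not be defined there, since
one can restrict to the part of it with exponents in the local ring (`Point.evalHom_eq_zero`). By
the Schwartz–Zippel lemma, with high probability the exponents of the numerator are defined, one of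
them is different from the others modulo `q`, and its coefficient is not zero modulo `p`. What
remains is a sparse polynomial in a random `q`-th root of unity `ω`. Replacing `ω` by a suitable
power, which permutes the roots of unity, brings all exponents close to zero modulo `q` by the
pigeonhole principle, so that the number of zeros is at most about `q ^ (1 - 3 / (4 * k))`
(`card_sparse_zeros_le`). Altogether, an admissible test is passed with probability at most
`q ^ (-1 / (2 * k))` (`uniformProb_pass_le`), for all large `q`. Together with the fact that almost
all tests are admissible (`eventually_admissible`), this gives the number of tests.
-/

noncomputable section

namespace MuGraph

/-! ### Comparing two interpretations along a graph -/

/-- The operators of the interpretations `I` and `J` preserve the relation `R`, where `R n` is the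
relation between values that are computed with at most `n` exponentiations on each path. -/
structure Interp.Respects {V W : Type} (I : Interp V) (J : Interp W) (R : ℕ → V → W → Prop) :
    Prop where
  mono : ∀ {m n : ℕ} {v : V} {w : W}, m ≤ n → R m v w → R n v w
  multilinear : ∀ {n : ℕ} {ins : List Shape} {out : Shape} (f : MultilinearOp ins out)
    (X : (i : Fin ins.length) → Tensor V (ins.get i))
    (Y : (i : Fin ins.length) → Tensor W (ins.get i)),
    (∀ i j, R n (X i j) (Y i j)) → ∀ o, R n (I.multilinear f X o) (J.multilinear f Y o)
  sum : ∀ {n : ℕ} {ι : Type} [Fintype ι] (x : ι → V) (y : ι → W),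
    (∀ i, R n (x i) (y i)) → R n (I.sum x) (J.sum y)
  div : ∀ {n : ℕ} {v v' : V} {w w' : W}, R n v w → R n v' w' → R n (I.div v v') (J.div w w')
  exp : ∀ {n : ℕ} {v : V} {w : W}, R n v w → R (n + 1) (I.exp v) (J.exp w)

section Respects

variable {V W : Type} {I : Interp V} {J : Interp W} {R : ℕ → V → W → Prop}

theorem PrimOp.eval_rel (h : I.Respects J R) {ins : List Shape} {out : Shape}
    (op : PrimOp ins out) (n : Assign (fun _ => ℕ) ins) (X : Env V ins) (Y : Env W ins)
    (hXY : ∀ (s : Shape) (v : Var ins s) (j : Idx s), R (n v) (X v j) (Y v j)) (j : Idx out) :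
    R ((Finset.univ.sup fun i : Fin ins.length => @n (ins.get i) (Var.get ins i)) + op.expCount)
      (op.eval I X j) (op.eval J Y j) := by
  have key : ∀ (i : Fin ins.length) (k : Idx (ins.get i)),
      R (Finset.univ.sup fun i : Fin ins.length => @n (ins.get i) (Var.get ins i))
        (X (Var.get ins i) k) (Y (Var.get ins i) k) := fun i k =>
    h.mono (Finset.le_sup (f := fun i : Fin ins.length => @n (ins.get i) (Var.get ins i))
      (Finset.mem_univ i)) (hXY _ _ _)
  cases op with
  | multilinear f => exact h.multilinear f _ _ key j
  | add s =>
    refine h.sum _ _ fun i => ?_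
    fin_cases i
    · exact key ⟨0, by simp⟩ j
    · exact key ⟨1, by simp⟩ j
  | div s => exact h.div (key ⟨0, by simp⟩ j) (key ⟨1, by simp⟩ j)
  | exp s => exact h.exp (key ⟨0, by simp⟩ j)

theorem Assign.push_rel {Γ : List Shape} {t : Shape} {m : ℕ} {a : Tensor V t} {b : Tensor W t}
    {n : Assign (fun _ => ℕ) Γ} {X : Env V Γ} {Y : Env W Γ} (hab : ∀ j, R m (a j) (b j))
    (hXY : ∀ (s : Shape) (v : Var Γ s) (j : Idx s), R (n v) (X v j) (Y v j)) :
    ∀ (s : Shape) (v : Var (t :: Γ) s) (j : Idx s),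
      R (Assign.push (A := fun _ => ℕ) m n v) (Assign.push (A := Tensor V) a X v j)
        (Assign.push (A := Tensor W) b Y v j)
  | _, .zero => hab
  | _, .succ v => hXY _ v

theorem Assign.append_rel {Γ : List Shape} {n : Assign (fun _ => ℕ) Γ} {X : Env V Γ}
    {Y : Env W Γ} (hXY : ∀ (s : Shape) (v : Var Γ s) (j : Idx s), R (n v) (X v j) (Y v j)) :
    ∀ (Δ : List Shape) {n' : Assign (fun _ => ℕ) Δ} {X' : Env V Δ} {Y' : Env W Δ}
      (_ : ∀ (s : Shape) (v : Var Δ s) (j : Idx s), R (n' v) (X' v j) (Y' v j))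
      (s : Shape) (v : Var (Δ ++ Γ) s) (j : Idx s),
      R (Assign.append (A := fun _ => ℕ) Δ n' n v) (Assign.append (A := Tensor V) Δ X' X v j)
        (Assign.append (A := Tensor W) Δ Y' Y v j)
  | [], _, _, _, _ => hXY
  | _ :: Δ, _, _, _, h' =>
    Assign.push_rel (h' _ .zero) (Assign.append_rel hXY Δ fun s v => h' s (.succ v))

/-- A relation that all operators preserve is preserved by graphs; each output is computed with at
most `expDepth` exponentiations. -/
theorem Graph.eval_rel (h : I.Respects J R) {l : ℕ} {Γ Δ : List Shape} (G : Graph l Γ Δ)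
    (n : Assign (fun _ => ℕ) Γ) (X : Env V Γ) (Y : Env W Γ)
    (hXY : ∀ (s : Shape) (v : Var Γ s) (j : Idx s), R (n v) (X v j) (Y v j)) :
    ∀ (s : Shape) (v : Var Δ s) (j : Idx s),
      R (G.expDepth n v) (G.eval I X v j) (G.eval J Y v j) := by
  induction G with
  | ret outs => exact fun s v => hXY s (outs v)
  | prim op args rest ih =>
    exact ih _ _ _ (Assign.push_rel
      (PrimOp.eval_rel h op (fun _ v => n (args v)) _ _ fun s v => hXY s (args v)) hXY)
  | call grid loops iters body accums post savers rest ihb ihp ihr =>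
    refine ihr _ _ _ (Assign.append_rel hXY _ fun s v j => ihp _ _ _ (fun s a i => ?_) _ _ _)
    have hb : ∀ r, ∀ (s : Shape) (v' : Var _ s) (j' : Idx s), R _ _ _ := fun r =>
      ihb _ (fun _ c i => X (iters c).src ((iters c).map ((savers v).map.symm j).1 r i))
        (fun _ c i => Y (iters c).src ((iters c).map ((savers v).map.symm j).1 r i))
        fun s c i => hXY _ _ _
    generalize accums a = acc
    obtain ⟨s', src, kind⟩ := acc
    cases kind with
    | sum => exact h.sum _ _ fun r => hb r _ _ _
    | concat e => exact hb _ _ _ _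

/-- The comparison of two runs of a graph under a relation that does not depend on the number of
exponentiations. -/
theorem Graph.run_rel {R : V → W → Prop} (h : I.Respects J fun _ => R) {l : ℕ}
    {Γ Δ : List Shape} (G : Graph l Γ Δ) {x : Entry Γ → V} {y : Entry Γ → W}
    (hxy : ∀ i, R (x i) (y i)) (e : Entry Δ) : R (G.run I x e) (G.run J y e) :=
  Graph.eval_rel h G (fun _ _ => 0) _ _ (fun _ _ _ => hxy _) _ _ _

/-- The comparison of two runs of a Lax graph. -/
theorem Graph.IsLax.run_rel (h : I.Respects J R) {l : ℕ} {Γ Δ : List Shape} {G : Graph l Γ Δ}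
    (hG : G.IsLax) {x : Entry Γ → V} {y : Entry Γ → W} (hxy : ∀ i, R 0 (x i) (y i))
    (e : Entry Δ) : R 1 (G.run I x e) (G.run J y e) :=
  h.mono (hG _ _) (Graph.eval_rel h G (fun _ _ => 0) _ _ (fun _ _ _ => hxy _) _ _ _)

end Respects

/-- The pointwise interpretation on a family of domains. -/
def Interp.pi {X : Type} {V : X → Type} (I : ∀ x, Interp (V x)) : Interp (∀ x, V x) where
  multilinear f Y := fun o x => (I x).multilinear f (fun i j => Y i j x) o
  sum Y := fun x => (I x).sum fun i => Y i x
  div v w := fun x => (I x).div (v x) (w x)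
  exp v := fun x => (I x).exp (v x)

theorem Graph.run_pi {X : Type} {V : X → Type} (I : ∀ x, Interp (V x)) {l : ℕ}
    {Γ Δ : List Shape} (G : Graph l Γ Δ) (y : Entry Γ → ∀ x, V x) (e : Entry Δ) (x : X) :
    G.run (Interp.pi I) y e x = G.run (I x) (fun i => y i x) e := by
  refine Graph.run_rel (R := fun (v : ∀ x, V x) w => v x = w) ?_ G (fun i => rfl) e
  refine ⟨fun _ h => h, ?_, ?_, ?_, ?_⟩
  · intro _ _ _ f X Y h o
    have : (fun i j => X i j x) = Y := funext fun i => funext fun j => h i j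
    exact congrArg (fun Y => (I x).multilinear f Y o) this
  · intro _ _ _ a b h
    exact congrArg (I x).sum (funext h)
  · rintro _ v v' w w' rfl rfl
    rfl
  · rintro _ v w rfl
    rfl

/-! ### Interpretations on pairs -/

/-- Values are pairs of an outer component in `F₁` and a component in `F₂` for use inside of
exponents. Exponentiation applies `χ` to the second component, and its result has no second
component. -/
def pairInterp {F₁ F₂ : Type} [Field F₁] [Field F₂] (χ : F₂ → F₁) :
    Interp (Option F₁ × Option F₂) where
  multilinear f X := fun o =>
    (multilinearOpt f (fun i j => (X i j).1) o, multilinearOpt f (fun i j => (X i j).2) o)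
  sum x := (sumOpt (fun i => (x i).1), sumOpt (fun i => (x i).2))
  div x y := (divOpt x.1 y.1, divOpt x.2 y.2)
  exp x := (x.2.map χ, none)

/-- The first component of the result of a graph under a pair interpretation. -/
def Graph.pairRun {F₁ F₂ : Type} [Field F₁] [Field F₂] (χ : F₂ → F₁) {l : ℕ} {Γ Δ : List Shape}
    (G : Graph l Γ Δ) (x₁ : Entry Γ → F₁) (x₂ : Entry Γ → F₂) (e : Entry Δ) : Option F₁ :=
  (G.run (pairInterp χ) (fun i => (some (x₁ i), some (x₂ i))) e).1

section PartialOps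

variable {F : Type}

theorem sumOpt_eq_some [CommRing F] {ι : Type} [Fintype ι] {x : ι → Option F} {a : F} :
    sumOpt x = some a ↔ ∃ y : ι → F, (∀ i, x i = some (y i)) ∧ a = ∑ i, y i := by
  classical
  unfold sumOpt
  constructor
  · intro h
    split_ifs at h with hx
    refine ⟨fun i => (x i).getD 0, fun i => ?_, by simpa using h.symm⟩
    obtain ⟨b, hb⟩ := Option.isSome_iff_exists.1 (hx i)
    simp [hb]
  · rintro ⟨y, hy, rfl⟩
    simp [hy]

theorem multilinearOpt_eq_some [CommRing F] {ins : List Shape} {out : Shape}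
    {f : MultilinearOp ins out} {X : (i : Fin ins.length) → Tensor (Option F) (ins.get i)}
    {o : Idx out} {a : F} :
    multilinearOpt f X o = some a ↔
      ∃ y : (i : Fin ins.length) → Tensor F (ins.get i),
        (∀ idx, f.coeff o idx ≠ 0 → ∀ i, X i (idx i) = some (y i (idx i))) ∧
        a = ∑ idx, (f.coeff o idx : F) * ∏ i, y i (idx i) := by
  classical
  unfold multilinearOpt
  constructor
  · intro h
    split_ifs at h with hx
    refine ⟨fun i j => (X i j).getD 0, fun idx hidx i => ?_, by simpa using h.symm⟩
    obtain ⟨b, hb⟩ := Option.isSome_iff_exists.1 (hx idx hidx i)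
    simp [hb]
  · rintro ⟨y, hy, rfl⟩
    rw [if_pos fun idx hidx i => by simp [hy idx hidx i]]
    refine congrArg some (Finset.sum_congr rfl fun idx _ => ?_)
    by_cases h0 : f.coeff o idx = 0
    · simp [h0]
    · congr 1
      exact Finset.prod_congr rfl fun i _ => by simp [hy idx h0 i]

theorem divOpt_eq_some [Field F] {x y : Option F} {a : F} :
    divOpt x y = some a ↔ ∃ b c, x = some b ∧ y = some c ∧ c ≠ 0 ∧ a = b / c := by
  classical
  cases x <;> cases y <;> simp [divOpt]
  exact fun _ => eq_comm

end PartialOps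

/-! ### Places -/

/-- A place of the field `L` with values in the field `F`: a ring homomorphism to `F` from a local
subring of `L`, whose maximal ideal is the kernel. It plays the role of evaluating formal
expressions, the elements of `L`, at a point; the evaluation is undefined outside of `ring`. -/
structure Place (L F : Type) [Field L] [Field F] where
  ring : Subring L
  ev : ring →+* F
  inv_mem : ∀ r : ring, ev r ≠ 0 → (r : L)⁻¹ ∈ ring

namespace Place

variable {L F : Type} [Field L] [Field F] (P : Place L F)

/-- The place `P` is defined at `l`, and has the value `a`. -/
def Spec (l : L) (a : F) : Prop := ∃ h : l ∈ P.ring, P.ev ⟨l, h⟩ = a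

variable {P}

theorem Spec.unique {l : L} {a b : F} (ha : P.Spec l a) (hb : P.Spec l b) : a = b := by
  obtain ⟨h, rfl⟩ := ha
  obtain ⟨_, rfl⟩ := hb
  rfl

theorem spec_zero : P.Spec 0 0 := ⟨P.ring.zero_mem, map_zero P.ev⟩

theorem Spec.sub {l m : L} {a b : F} (ha : P.Spec l a) (hb : P.Spec m b) :
    P.Spec (l - m) (a - b) := by
  obtain ⟨h, rfl⟩ := ha
  obtain ⟨h', rfl⟩ := hb
  exact ⟨P.ring.sub_mem h h', map_sub P.ev ⟨l, h⟩ ⟨m, h'⟩⟩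

theorem Spec.add {l m : L} {a b : F} (ha : P.Spec l a) (hb : P.Spec m b) :
    P.Spec (l + m) (a + b) := by
  obtain ⟨h, rfl⟩ := ha
  obtain ⟨h', rfl⟩ := hb
  exact ⟨P.ring.add_mem h h', map_add P.ev ⟨l, h⟩ ⟨m, h'⟩⟩

theorem Spec.mul {l m : L} {a b : F} (ha : P.Spec l a) (hb : P.Spec m b) :
    P.Spec (l * m) (a * b) := by
  obtain ⟨h, rfl⟩ := ha
  obtain ⟨h', rfl⟩ := hb
  exact ⟨P.ring.mul_mem h h', map_mul P.ev ⟨l, h⟩ ⟨m, h'⟩⟩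

theorem spec_intCast (n : ℤ) : P.Spec (n : L) (n : F) :=
  ⟨intCast_mem P.ring n, map_intCast P.ev n⟩

theorem Spec.sum {ι : Type*} {s : Finset ι} {l : ι → L} {a : ι → F}
    (h : ∀ i ∈ s, P.Spec (l i) (a i)) : P.Spec (∑ i ∈ s, l i) (∑ i ∈ s, a i) := by
  classical
  induction s using Finset.induction_on with
  | empty => exact spec_zero
  | insert i s hi ih =>
    rw [Finset.sum_insert hi, Finset.sum_insert hi]
    exact (h i (Finset.mem_insert_self i s)).add
      (ih fun k hk => h k (Finset.mem_insert_of_mem hk))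

theorem Spec.prod {ι : Type*} {s : Finset ι} {l : ι → L} {a : ι → F}
    (h : ∀ i ∈ s, P.Spec (l i) (a i)) : P.Spec (∏ i ∈ s, l i) (∏ i ∈ s, a i) := by
  classical
  induction s using Finset.induction_on with
  | empty => exact ⟨P.ring.one_mem, map_one P.ev⟩
  | insert i s hi ih =>
    rw [Finset.prod_insert hi, Finset.prod_insert hi]
    exact (h i (Finset.mem_insert_self i s)).mul
      (ih fun k hk => h k (Finset.mem_insert_of_mem hk))

theorem Spec.ne_zero {l : L} {a : F} (h : P.Spec l a) (ha : a ≠ 0) : l ≠ 0 := by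
  rintro rfl
  exact ha (h.unique spec_zero)

theorem Spec.inv {l : L} {a : F} (h : P.Spec l a) (ha : a ≠ 0) : P.Spec l⁻¹ a⁻¹ := by
  have hl := h.ne_zero ha
  obtain ⟨h, rfl⟩ := h
  refine ⟨P.inv_mem _ ha, eq_inv_of_mul_eq_one_left ?_⟩
  rw [← map_mul, ← map_one P.ev]
  congr 1
  ext
  exact inv_mul_cancel₀ hl

theorem Spec.div {l m : L} {a b : F} (ha : P.Spec l a) (hb : P.Spec m b) (h0 : b ≠ 0) :
    P.Spec (l / m) (a / b) := by
  rw [div_eq_mul_inv, div_eq_mul_inv]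
  exact ha.mul (hb.inv h0)

section OfHom

variable {D : Type} [CommRing D]

/-- The elements that a ring homomorphism to a field does not send to zero. -/
def nonvanishing (ev : D →+* F) : Submonoid D := (nonZeroDivisors F).comap ev

theorem nonvanishing_ne (ev : D →+* F) (y : nonvanishing ev) : ev y ≠ 0 :=
  nonZeroDivisors.ne_zero y.2

theorem map_nonvanishing_ne (i : D →+* L) (hi : Function.Injective i) (ev : D →+* F)
    (y : nonvanishing ev) : i y ≠ 0 := by
  intro h
  apply nonvanishing_ne ev y
  rw [hi (h.trans (map_zero i).symm), map_zero]

variable (i : D →+* L) (hi : Function.Injective i) (ev : D →+* F)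

/-- The localization of `D` at the kernel of `ev`, as a part of the field `L`. -/
def localHom : Localization (nonvanishing ev) →+* L :=
  IsLocalization.lift fun y => isUnit_iff_ne_zero.2 (map_nonvanishing_ne i hi ev y)

/-- The extension of `ev` to the localization at its kernel. -/
def localEv : Localization (nonvanishing ev) →+* F :=
  IsLocalization.lift fun y => isUnit_iff_ne_zero.2 (nonvanishing_ne ev y)

theorem localHom_mk (a : D) (s : nonvanishing ev) :
    localHom i hi ev (IsLocalization.mk' _ a s) = i a / i s := by
  rw [eq_div_iff (map_nonvanishing_ne i hi ev s), mul_comm]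
  exact ((IsLocalization.lift_mk'_spec _ _ _ _).1 rfl).symm

theorem localEv_mk (a : D) (s : nonvanishing ev) :
    localEv ev (IsLocalization.mk' _ a s) = ev a / ev s := by
  rw [eq_div_iff (nonvanishing_ne ev s), mul_comm]
  exact ((IsLocalization.lift_mk'_spec _ _ _ _).1 rfl).symm

theorem localHom_injective : Function.Injective (localHom i hi ev) := by
  rw [injective_iff_map_eq_zero]
  intro z hz
  obtain ⟨⟨a, s⟩, rfl⟩ := IsLocalization.mk'_surjective (nonvanishing ev) z
  dsimp only at hz ⊢
  rw [localHom_mk, div_eq_zero_iff, or_iff_left (map_nonvanishing_ne i hi ev s)] at hz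
  have ha : a = 0 := hi (hz.trans (map_zero i).symm)
  rw [ha, IsLocalization.mk'_zero]

/-- The localization at the kernel of `ev` is isomorphic to its image in `L`. -/
def localEquiv : Localization (nonvanishing ev) ≃+* (localHom i hi ev).range :=
  RingEquiv.ofBijective (localHom i hi ev).rangeRestrict
    ⟨fun _ _ h => localHom_injective i hi ev (congrArg Subtype.val h),
      (localHom i hi ev).rangeRestrict_surjective⟩

/-- The place on the field `L` that extends a ring homomorphism from a subring `D` to a field: it is
defined on the localization of `D` at the kernel. -/
def ofHom : Place L F where
  ring := (localHom i hi ev).range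
  ev := (localEv ev).comp (localEquiv i hi ev).symm.toRingHom
  inv_mem := by
    intro r hr
    obtain ⟨z, rfl⟩ := (localEquiv i hi ev).surjective r
    obtain ⟨⟨a, s⟩, rfl⟩ := IsLocalization.mk'_surjective (nonvanishing ev) z
    have ha : ev a ≠ 0 := by
      intro h0
      apply hr
      simp [localEv_mk, h0]
    refine ⟨IsLocalization.mk' _ (s : D) (⟨a, mem_nonZeroDivisors_of_ne_zero ha⟩ :
      nonvanishing ev), ?_⟩
    change _ = (localHom i hi ev _)⁻¹
    rw [localHom_mk, localHom_mk, inv_div]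

theorem ofHom_spec_localHom (z : Localization (nonvanishing ev)) :
    (ofHom i hi ev).Spec (localHom i hi ev z) (localEv ev z) :=
  ⟨⟨z, rfl⟩, congrArg (localEv ev) ((localEquiv i hi ev).symm_apply_apply z)⟩

variable {i hi ev}

theorem ofHom_spec_iff {l : L} {a : F} : (ofHom i hi ev).Spec l a ↔
    ∃ n d : D, ev d ≠ 0 ∧ l = i n / i d ∧ a = ev n / ev d := by
  constructor
  · rintro ⟨⟨z, rfl⟩, h⟩
    obtain ⟨⟨n, s⟩, rfl⟩ := IsLocalization.mk'_surjective (nonvanishing ev) z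
    refine ⟨n, s, nonvanishing_ne ev s, localHom_mk i hi ev n s, ?_⟩
    rw [← localEv_mk]
    exact Spec.unique ⟨_, h⟩ (ofHom_spec_localHom i hi ev _)
  · rintro ⟨n, d, hd, rfl, rfl⟩
    have := ofHom_spec_localHom i hi ev
      (IsLocalization.mk' _ n (⟨d, mem_nonZeroDivisors_of_ne_zero hd⟩ : nonvanishing ev))
    rwa [localHom_mk, localEv_mk] at this

theorem ofHom_spec (n : D) : (ofHom i hi ev).Spec (i n) (ev n) :=
  ofHom_spec_iff.2 ⟨n, 1, by simp, by simp, by simp⟩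

end OfHom

end Place

/-! ### Evaluation at places -/

section Evaluation

variable {K L : Type} [Field K] [Field L] {E : K → L}

section Specialize

variable {F₁ F₂ : Type} [Field F₁] [Field F₂] {χ : F₂ → F₁} {P₂ : Place K F₂} {P₁ : Place L F₁}

theorem sumOpt_specialize {L F : Type} [Field L] [Field F] {P : Place L F} {ι : Type} [Fintype ι]
    {x : ι → Option F} {y : ι → Option L}
    (h : ∀ i, ∀ a, x i = some a → ∃ l, y i = some l ∧ P.Spec l a) :
    ∀ a, sumOpt x = some a → ∃ l, sumOpt y = some l ∧ P.Spec l a := by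
  intro a ha
  obtain ⟨a, hxa, rfl⟩ := sumOpt_eq_some.1 ha
  choose l hl hs using fun i => h i _ (hxa i)
  exact ⟨_, sumOpt_eq_some.2 ⟨l, hl, rfl⟩, Place.Spec.sum fun i _ => hs i⟩

theorem divOpt_specialize {L F : Type} [Field L] [Field F] {P : Place L F}
    {x x' : Option F} {y y' : Option L}
    (h : ∀ a, x = some a → ∃ l, y = some l ∧ P.Spec l a)
    (h' : ∀ a, x' = some a → ∃ l, y' = some l ∧ P.Spec l a) :
    ∀ a, divOpt x x' = some a → ∃ l, divOpt y y' = some l ∧ P.Spec l a := by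
  intro a ha
  obtain ⟨b, c, hb, hc, hc0, rfl⟩ := divOpt_eq_some.1 ha
  obtain ⟨l, hl, hs⟩ := h _ hb
  obtain ⟨l', hl', hs'⟩ := h' _ hc
  exact ⟨_, divOpt_eq_some.2 ⟨l, l', hl, hl', hs'.ne_zero hc0, rfl⟩, hs.div hs' hc0⟩

theorem multilinearOpt_specialize {L F : Type} [Field L] [Field F] {P : Place L F}
    {ins : List Shape} {out : Shape} {f : MultilinearOp ins out}
    {X : (i : Fin ins.length) → Tensor (Option F) (ins.get i)}
    {Y : (i : Fin ins.length) → Tensor (Option L) (ins.get i)}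
    (h : ∀ i j, ∀ a, X i j = some a → ∃ l, Y i j = some l ∧ P.Spec l a) (o : Idx out) :
    ∀ a, multilinearOpt f X o = some a → ∃ l, multilinearOpt f Y o = some l ∧ P.Spec l a := by
  intro a ha
  obtain ⟨x, hx, rfl⟩ := multilinearOpt_eq_some.1 ha
  have h1 : ∀ i j, ∃ l, X i j = some (x i j) → Y i j = some l ∧ P.Spec l (x i j) := by
    intro i j
    by_cases hij : X i j = some (x i j)
    · obtain ⟨l, hl⟩ := h i j _ hij
      exact ⟨l, fun _ => hl⟩
    · exact ⟨0, fun h => absurd h hij⟩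
  choose y hy using h1
  refine ⟨_, multilinearOpt_eq_some.2 ⟨y, fun idx h0 i => (hy i _ (hx idx h0 i)).1, rfl⟩,
    Place.Spec.sum fun idx _ => ?_⟩
  by_cases h0 : f.coeff o idx = 0
  · simp only [h0, Int.cast_zero, zero_mul]
    exact Place.spec_zero
  · exact (Place.spec_intCast _).mul (Place.Spec.prod fun i _ => (hy i _ (hx idx h0 i)).2)

/-- If the value of a graph is defined at a point, then its formal value is defined, and the place
belonging to the point sends the formal value to the value. -/
theorem Graph.exists_spec_of_pairRun (hE : ∀ r a, P₂.Spec r a → P₁.Spec (E r) (χ a))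
    {l : ℕ} {Γ Δ : List Shape} (G : Graph l Γ Δ) {x₁ : Entry Γ → F₁} {x₂ : Entry Γ → F₂}
    {y₁ : Entry Γ → L} {y₂ : Entry Γ → K} (h₁ : ∀ i, P₁.Spec (y₁ i) (x₁ i))
    (h₂ : ∀ i, P₂.Spec (y₂ i) (x₂ i)) (e : Entry Δ) {a : F₁} (ha : G.pairRun χ x₁ x₂ e = some a) :
    ∃ r, G.pairRun E y₁ y₂ e = some r ∧ P₁.Spec r a := by
  refine (Graph.run_rel (I := pairInterp χ) (J := pairInterp E)
    (R := fun v w => (∀ a, v.1 = some a → ∃ r, w.1 = some r ∧ P₁.Spec r a) ∧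
      (∀ a, v.2 = some a → ∃ r, w.2 = some r ∧ P₂.Spec r a)) ⟨fun _ h => h, ?_, ?_, ?_, ?_⟩
      G (fun i => ⟨?_, ?_⟩) e).1 a ha
  · exact fun f X Y h o => ⟨multilinearOpt_specialize (fun i j => (h i j).1) o,
      multilinearOpt_specialize (fun i j => (h i j).2) o⟩
  · exact fun x y h => ⟨sumOpt_specialize fun i => (h i).1, sumOpt_specialize fun i => (h i).2⟩
  · exact fun h h' => ⟨divOpt_specialize h.1 h'.1, divOpt_specialize h.2 h'.2⟩
  · rintro _ v w ⟨-, h⟩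
    refine ⟨fun a ha => ?_, fun a ha => by simp [pairInterp] at ha⟩
    obtain ⟨b, hb, rfl⟩ := Option.map_eq_some_iff.1 ha
    obtain ⟨r, hr, hs⟩ := h b hb
    exact ⟨E r, by simp [pairInterp, hr], hE _ _ hs⟩
  · rintro _ ⟨⟩
    exact ⟨_, rfl, h₁ i⟩
  · rintro _ ⟨⟩
    exact ⟨_, rfl, h₂ i⟩

end Specialize

section Generic

open Filter

variable {X : Type}

/-- A family of places is generic along a filter if each nonzero element has, at almost all of the
places, a value that is not zero. -/
def GenericPlaces {L : Type} [Field L] {F : X → Type} [∀ x, Field (F x)] (𝓕 : Filter X)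
    (P : ∀ x, Place L (F x)) : Prop :=
  ∀ r : L, r ≠ 0 → ∀ᶠ x in 𝓕, ∃ a, a ≠ 0 ∧ (P x).Spec r a

section

variable {L : Type} [Field L] {F : X → Type} [∀ x, Field (F x)] {𝓕 : Filter X}
  {P : ∀ x, Place L (F x)}

theorem GenericPlaces.spec (hP : GenericPlaces 𝓕 P) (r : L) :
    ∀ᶠ x in 𝓕, ∃ a, (P x).Spec r a := by
  by_cases h : r = 0
  · subst h
    exact Eventually.of_forall fun x => ⟨0, Place.spec_zero⟩
  · exact (hP r h).mono fun x ⟨a, _, ha⟩ => ⟨a, ha⟩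

theorem GenericPlaces.eq_zero [NeBot 𝓕] (hP : GenericPlaces 𝓕 P) {r : L}
    (h : ∀ᶠ x in 𝓕, (P x).Spec r 0) : r = 0 := by
  by_contra hr
  obtain ⟨x, h0, a, ha, ha'⟩ := (h.and (hP r hr)).exists
  exact ha (ha'.unique h0)

theorem sumOpt_generic (hP : GenericPlaces 𝓕 P) {ι : Type} [Fintype ι] {x : ι → Option L}
    {y : ι → ∀ x, Option (F x)}
    (h : ∀ i l, x i = some l → ∀ᶠ t in 𝓕, ∀ a, (P t).Spec l a → y i t = some a) :
    ∀ l, sumOpt x = some l →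
      ∀ᶠ t in 𝓕, ∀ a, (P t).Spec l a → sumOpt (fun i => y i t) = some a := by
  intro l hl
  obtain ⟨l, hxl, rfl⟩ := sumOpt_eq_some.1 hl
  filter_upwards [eventually_all.2 fun i => h i _ (hxl i), eventually_all.2 fun i => hP.spec (l i)]
    with t ht hs a ha
  choose b hb using hs
  refine sumOpt_eq_some.2 ⟨b, fun i => ht i _ (hb i), ha.unique (Place.Spec.sum fun i _ => hb i)⟩

theorem divOpt_generic (hP : GenericPlaces 𝓕 P) {x x' : Option L} {y y' : ∀ x, Option (F x)}
    (h : ∀ l, x = some l → ∀ᶠ t in 𝓕, ∀ a, (P t).Spec l a → y t = some a)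
    (h' : ∀ l, x' = some l → ∀ᶠ t in 𝓕, ∀ a, (P t).Spec l a → y' t = some a) :
    ∀ l, divOpt x x' = some l →
      ∀ᶠ t in 𝓕, ∀ a, (P t).Spec l a → divOpt (y t) (y' t) = some a := by
  intro l hl
  obtain ⟨b, c, hb, hc, hc0, rfl⟩ := divOpt_eq_some.1 hl
  filter_upwards [h _ hb, h' _ hc, hP.spec b, hP c hc0] with t h1 h2 ⟨b', hb'⟩ ⟨c', h0, hc'⟩ a ha
  exact divOpt_eq_some.2 ⟨b', c', h1 _ hb', h2 _ hc', h0, ha.unique (hb'.div hc' h0)⟩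

theorem multilinearOpt_generic (hP : GenericPlaces 𝓕 P) {ins : List Shape} {out : Shape}
    {f : MultilinearOp ins out} {X : (i : Fin ins.length) → Tensor (Option L) (ins.get i)}
    {Y : (i : Fin ins.length) → Tensor (∀ x, Option (F x)) (ins.get i)}
    (h : ∀ i j l, X i j = some l → ∀ᶠ t in 𝓕, ∀ a, (P t).Spec l a → Y i j t = some a)
    (o : Idx out) :
    ∀ l, multilinearOpt f X o = some l →
      ∀ᶠ t in 𝓕, ∀ a, (P t).Spec l a → multilinearOpt f (fun i j => Y i j t) o = some a := by
  intro l hl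
  obtain ⟨x, hx, rfl⟩ := multilinearOpt_eq_some.1 hl
  have h1 : ∀ᶠ t in 𝓕, ∀ i j, X i j = some (x i j) →
      ∀ a, (P t).Spec (x i j) a → Y i j t = some a :=
    eventually_all.2 fun i => eventually_all.2 fun j => by
      by_cases hij : X i j = some (x i j)
      · exact (h i j _ hij).mono fun t ht _ => ht
      · exact Eventually.of_forall fun t h => absurd h hij
  filter_upwards [h1, eventually_all.2 fun i => eventually_all.2 fun j => hP.spec (x i j)]
    with t ht hs a ha
  choose b hb using hs
  refine multilinearOpt_eq_some.2 ⟨b, fun idx h0 i => ht _ _ (hx idx h0 i) _ (hb _ _),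
    ha.unique (Place.Spec.sum fun idx _ =>
      (Place.spec_intCast _).mul (Place.Spec.prod fun i _ => hb _ _))⟩

end

variable {F₁ F₂ : X → Type} [∀ x, Field (F₁ x)] [∀ x, Field (F₂ x)] {χ : ∀ x, F₂ x → F₁ x}
  {𝓕 : Filter X} {P₂ : ∀ x, Place K (F₂ x)} {P₁ : ∀ x, Place L (F₁ x)}

/-- If the formal value of a graph is defined, then its values at almost all points of a generic
family are defined, and are the values of the places at the formal value. -/
theorem Graph.eventually_pairRun (hP₂ : GenericPlaces 𝓕 P₂) (hP₁ : GenericPlaces 𝓕 P₁)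
    (hE : ∀ x r a, (P₂ x).Spec r a → (P₁ x).Spec (E r) (χ x a))
    {l : ℕ} {Γ Δ : List Shape} (G : Graph l Γ Δ) {x₁ : ∀ x, Entry Γ → F₁ x}
    {x₂ : ∀ x, Entry Γ → F₂ x} {y₁ : Entry Γ → L} {y₂ : Entry Γ → K}
    (h₁ : ∀ x i, (P₁ x).Spec (y₁ i) (x₁ x i)) (h₂ : ∀ x i, (P₂ x).Spec (y₂ i) (x₂ x i))
    (e : Entry Δ) {r : L} (hr : G.pairRun E y₁ y₂ e = some r) :
    ∀ᶠ x in 𝓕, ∃ a, (P₁ x).Spec r a ∧ G.pairRun (χ x) (x₁ x) (x₂ x) e = some a := by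
  have key := (Graph.run_rel (I := pairInterp E) (J := Interp.pi fun x => pairInterp (χ x))
    (R := fun v w =>
      (∀ r, v.1 = some r → ∀ᶠ x in 𝓕, ∀ a, (P₁ x).Spec r a → (w x).1 = some a) ∧
      (∀ r, v.2 = some r → ∀ᶠ x in 𝓕, ∀ a, (P₂ x).Spec r a → (w x).2 = some a))
      ⟨fun _ h => h, ?_, ?_, ?_, ?_⟩
      G (x := fun i => (some (y₁ i), some (y₂ i)))
      (y := fun i x => (some (x₁ x i), some (x₂ x i))) (fun i => ⟨?_, ?_⟩) e).1 r hr
  · filter_upwards [key, hP₁.spec r] with x hx ⟨a, ha⟩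
    refine ⟨a, ha, ?_⟩
    have := hx a ha
    rwa [Graph.run_pi] at this
  · exact fun f X Y h o =>
      ⟨multilinearOpt_generic (Y := fun i j x => (Y i j x).1) hP₁ (fun i j => (h i j).1) o,
        multilinearOpt_generic (Y := fun i j x => (Y i j x).2) hP₂ (fun i j => (h i j).2) o⟩
  · exact fun x y h => ⟨sumOpt_generic (y := fun i x => (y i x).1) hP₁ fun i => (h i).1,
      sumOpt_generic (y := fun i x => (y i x).2) hP₂ fun i => (h i).2⟩
  · exact fun {_ v v' w w'} h h' =>
      ⟨divOpt_generic (y := fun x => (w x).1) (y' := fun x => (w' x).1) hP₁ h.1 h'.1,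
        divOpt_generic (y := fun x => (w x).2) (y' := fun x => (w' x).2) hP₂ h.2 h'.2⟩
  · rintro _ v w ⟨-, h⟩
    refine ⟨fun r hr => ?_, fun r hr => by simp [pairInterp] at hr⟩
    obtain ⟨s, hs, rfl⟩ := Option.map_eq_some_iff.1 hr
    filter_upwards [h s hs, hP₂.spec s] with x hx ⟨b, hb⟩ a ha
    have := hx b hb
    simp only [Interp.pi, pairInterp, this, Option.map_some, Option.some.injEq]
    exact (hE _ _ _ hb).unique ha
  · rintro _ ⟨⟩
    exact Eventually.of_forall fun x a ha => congrArg some ((h₁ x i).unique ha)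
  · rintro _ ⟨⟩
    exact Eventually.of_forall fun x a ha => congrArg some ((h₂ x i).unique ha)

end Generic

end Evaluation

/-! ### Linear independence of the exponentials of rational numbers -/

section Transcendence

open Polynomial

/-- Hermite's theorem: the number `e` is transcendental. -/
theorem transcendental_exp_one : Transcendental ℤ (Real.exp 1) := by
  intro halg
  obtain ⟨Q, hQ0, hQ⟩ := halg.exists_nonzero_coeff_and_aeval_eq_zero
    (mem_nonZeroDivisors_of_ne_zero (Real.exp_ne_zero 1))
  set n := Q.natDegree
  let f : ℤ[X] := ∏ j ∈ Finset.range n, (X - C ((j : ℤ) + 1))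
  have hf0 : f.eval 0 ≠ 0 := by
    simp only [f, eval_prod, eval_sub, eval_X, eval_C]
    exact Finset.prod_ne_zero_iff.2 fun j _ => by omega
  have hroot : ∀ j ∈ Finset.range n, ((j : ℂ) + 1) ∈ f.aroots ℂ := by
    intro j hj
    rw [mem_aroots]
    refine ⟨fun h => hf0 (by rw [h, eval_zero]), ?_⟩
    simp only [f, map_prod]
    exact Finset.prod_eq_zero hj (by simp)
  have hQC : ∑ i ∈ Finset.range (n + 1), (Q.coeff i : ℂ) * Complex.exp i = 0 := by
    have h1 : ∑ i ∈ Finset.range (n + 1), (Q.coeff i : ℝ) * Real.exp i = 0 := by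
      rw [aeval_eq_sum_range] at hQ
      rw [← hQ]
      exact Finset.sum_congr rfl fun i _ => by simp [← Real.exp_nat_mul]
    simpa using congrArg (fun x : ℝ => (x : ℂ)) h1
  obtain ⟨c, hc⟩ := LindemannWeierstrass.exp_polynomial_approx f hf0
  set B : ℝ := ∑ j ∈ Finset.range n, ‖(Q.coeff (j + 1) : ℂ)‖
  have hlim : Filter.Tendsto (fun m : ℕ => B * (c * (c ^ m / (m.factorial : ℝ)))) Filter.atTop
      (nhds 0) := by
    simpa using ((FloorSemiring.tendsto_pow_div_factorial_atTop c).const_mul c).const_mul B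
  obtain ⟨m₀, hm₀⟩ := (hlim.eventually (gt_mem_nhds one_pos)).exists_forall_of_atTop
  obtain ⟨p, hp, hprime⟩ := Nat.exists_infinite_primes
    (m₀ + (f.eval 0).natAbs + (Q.coeff 0).natAbs + 2)
  obtain ⟨N, hN, g, -, hg⟩ := hc p (by omega) hprime
  -- The integer part of the approximate relation between the powers of `e`.
  let Z : ℤ := N * Q.coeff 0 + p * ∑ j ∈ Finset.range n, Q.coeff (j + 1) * g.eval ((j : ℤ) + 1)
  have hZ : (Z : ℂ) = -∑ j ∈ Finset.range n, (Q.coeff (j + 1) : ℂ) *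
      (N • Complex.exp ((j : ℂ) + 1) - p • aeval ((j : ℂ) + 1) g) := by
    rw [Finset.sum_range_succ'] at hQC
    have hg' : ∀ j : ℕ, aeval ((j : ℂ) + 1) g = ((g.eval ((j : ℤ) + 1) : ℤ) : ℂ) := by
      intro j
      have := aeval_algebraMap_apply_eq_algebraMap_eval (A := ℂ) ((j : ℤ) + 1) g
      simpa using this
    simp only [hg', zsmul_eq_mul, nsmul_eq_mul, mul_sub, Finset.sum_sub_distrib]
    have h1 : ∑ j ∈ Finset.range n, (Q.coeff (j + 1) : ℂ) * (N * Complex.exp ((j : ℂ) + 1)) =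
        -(N * Q.coeff 0) := by
      have h2 : ∑ j ∈ Finset.range n, (Q.coeff (j + 1) : ℂ) * Complex.exp ((j : ℂ) + 1) =
          -Q.coeff 0 := by
        rw [eq_neg_iff_add_eq_zero, ← hQC]
        simp
      rw [← mul_neg, ← h2, Finset.mul_sum]
      exact Finset.sum_congr rfl fun j _ => by ring
    rw [h1]
    simp only [Z]
    push_cast
    rw [Finset.mul_sum]
    have h3 : ∀ j : ℕ, (p : ℂ) * ((Q.coeff (j + 1) : ℂ) * ((g.eval ((j : ℤ) + 1) : ℤ) : ℂ)) =
      (Q.coeff (j + 1) : ℂ) * (p * ((g.eval ((j : ℤ) + 1) : ℤ) : ℂ)) := fun j => by ring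
    simp only [h3]
    ring
  have hZ1 : ‖(Z : ℂ)‖ < 1 := by
    rw [hZ, norm_neg]
    calc _ ≤ ∑ j ∈ Finset.range n, ‖(Q.coeff (j + 1) : ℂ)‖ * (c ^ p / ((p - 1).factorial : ℝ)) := by
          refine norm_sum_le_of_le _ fun j hj => ?_
          rw [norm_mul]
          exact mul_le_mul_of_nonneg_left (hg (hroot j hj)) (norm_nonneg _)
      _ = B * (c * (c ^ (p - 1) / ((p - 1).factorial : ℝ))) := by
          rw [← Finset.sum_mul, ← mul_div_assoc c, ← pow_succ', Nat.sub_add_cancel hprime.one_le]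
      _ < 1 := hm₀ _ (by omega)
  have hZ0 : Z = 0 := by
    rw [Complex.norm_intCast] at hZ1
    exact Int.abs_lt_one_iff.1 (by exact_mod_cast hZ1)
  have hdvd : (p : ℤ) ∣ N * Q.coeff 0 := by
    rw [← Int.dvd_add_left (dvd_mul_right (p : ℤ) _)]
    exact hZ0 ▸ dvd_zero _
  rcases (Nat.prime_iff_prime_int.1 hprime).dvd_or_dvd hdvd with h | h
  · exact hN h
  · have := Int.le_of_dvd (abs_pos.2 hQ0) ((dvd_abs _ _).2 h)
    rw [Int.abs_eq_natAbs] at this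
    omega

/-- A rational linear combination of exponentials of rational numbers vanishes only if, for each
exponent, the coefficients add up to zero. -/
theorem sum_filter_eq_zero_of_sum_exp {k : ℕ} (c r : Fin k → ℚ)
    (h : ∑ i, (c i : ℝ) * Real.exp (r i) = 0) (i₀ : Fin k) : ∑ i with r i = r i₀, c i = 0 := by
  obtain ⟨M, hM0, z, hz⟩ : ∃ M : ℕ, 0 < M ∧ ∃ z : Fin k → ℤ, ∀ i, r i * M = z i := by
    refine ⟨∏ i, (r i).den, Finset.prod_pos fun i _ => (r i).pos,
      fun i => (r i).num * ∏ j ∈ Finset.univ.erase i, ((r j).den : ℤ), fun i => ?_⟩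
    rw [← Finset.mul_prod_erase Finset.univ (fun i => (r i).den) (Finset.mem_univ i)]
    push_cast
    rw [← mul_assoc, Rat.mul_den_eq_num]
  obtain ⟨m, hm⟩ : ∃ m : ℕ, ∀ i, 0 ≤ z i + m := by
    refine ⟨∑ i, (z i).natAbs, fun i => ?_⟩
    have := Finset.single_le_sum (f := fun i => (z i).natAbs) (fun i _ => Nat.zero_le _)
      (Finset.mem_univ i)
    omega
  have hMR : (M : ℝ) ≠ 0 := by positivity
  set t := Real.exp (1 / M)
  have ht : Transcendental ℚ t := by
    have h1 : Transcendental ℤ (t ^ M) := by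
      rw [← Real.exp_nat_mul, mul_one_div_cancel hMR]
      exact transcendental_exp_one
    intro halg
    have h2 : IsAlgebraic ℤ t := (IsFractionRing.isAlgebraic_iff ℤ ℚ ℝ).2 halg
    exact h1 (h2.pow M)
  let e : Fin k → ℕ := fun i => (z i + m).toNat
  have he : ∀ i, (e i : ℤ) = z i + m := fun i => Int.toNat_of_nonneg (hm i)
  have hpow : ∀ i, t ^ e i = Real.exp (r i) * t ^ m := by
    intro i
    have h1 : ((e i : ℕ) : ℝ) = r i * M + m := by
      have h2 : (r i : ℝ) * M = z i := by exact_mod_cast congrArg (fun x : ℚ => (x : ℝ)) (hz i)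
      rw [h2]
      exact_mod_cast he i
    rw [← Real.exp_nat_mul, ← Real.exp_nat_mul, ← Real.exp_add, h1]
    congr 1
    field_simp
  let Q : ℚ[X] := ∑ i, C (c i) * X ^ e i
  have hQ : Q = 0 := by
    by_contra hne
    refine ht ⟨Q, hne, ?_⟩
    simp only [Q, map_sum, map_mul, map_pow, aeval_X, aeval_C, hpow, ← mul_assoc]
    rw [← Finset.sum_mul]
    simpa using Or.inl h
  have hcoeff := congrArg (fun Q : ℚ[X] => Q.coeff (e i₀)) hQ
  simp only [Q, finsetSum_coeff, coeff_C_mul, coeff_X_pow, coeff_zero, mul_ite, mul_one,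
    mul_zero] at hcoeff
  rw [← Finset.sum_filter] at hcoeff
  rw [← hcoeff]
  refine Finset.sum_congr (Finset.filter_congr fun i _ => ?_) fun _ _ => rfl
  have hMQ : (M : ℚ) ≠ 0 := by positivity
  rw [← mul_left_inj' hMQ, hz, hz]
  have := he i
  have := he i₀
  constructor
  · intro h
    have : z i = z i₀ := by exact_mod_cast h
    omega
  · intro h
    have : z i = z i₀ := by omega
    exact_mod_cast this

end Transcendence

open Filter MvPolynomial

/-! ### Formal values and their evaluation at points -/

/-- A point at which formal values can be evaluated: coordinates in `F₁` for use outside of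
exponents, coordinates in `F₂` for use inside of exponents, and an exponential function. -/
structure Point (σ F₁ F₂ : Type) [Field F₁] [Field F₂] where
  fst : σ → F₁
  snd : σ → F₂
  char : AddChar F₂ F₁

section Formal

variable {σ : Type} (K : Type) [Field K] [Algebra (MvPolynomial σ ℤ) K]

/-- The formal expression `∑ i, f i * exp (g i / h i)`. The exponents are elements of the field `K`
of rational functions; the formal exponentials of different exponents are linearly independent. -/
def expSum {k : ℕ} (f g h : Fin k → MvPolynomial σ ℤ) : AddMonoidAlgebra (MvPolynomial σ ℤ) K :=
  ∑ i, AddMonoidAlgebra.single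
    (algebraMap (MvPolynomial σ ℤ) K (g i) / algebraMap (MvPolynomial σ ℤ) K (h i)) (f i)

theorem exists_expSum_eq [IsFractionRing (MvPolynomial σ ℤ) K]
    (N : AddMonoidAlgebra (MvPolynomial σ ℤ) K) :
    ∃ (k : ℕ) (f g h : Fin k → MvPolynomial σ ℤ), (∀ i, h i ≠ 0) ∧ expSum K f g h = N := by
  classical
  have hr : ∀ r : K, ∃ g h : MvPolynomial σ ℤ, h ≠ 0 ∧
      algebraMap (MvPolynomial σ ℤ) K g / algebraMap (MvPolynomial σ ℤ) K h = r := by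
    intro r
    obtain ⟨g, h, hh, hr⟩ := IsFractionRing.div_surjective (A := MvPolynomial σ ℤ) r
    exact ⟨g, h, nonZeroDivisors.ne_zero hh, hr⟩
  choose g h hh hgh using hr
  let u := N.coeff.support.equivFin.symm
  refine ⟨_, fun i => N.coeff (u i), fun i => g (u i), fun i => h (u i), fun i => hh _, ?_⟩
  simp only [expSum, hgh]
  rw [Equiv.sum_comp u fun r : N.coeff.support => AddMonoidAlgebra.single (r : K) (N.coeff r),
    Finset.sum_coe_sort N.coeff.support fun r => AddMonoidAlgebra.single r (N.coeff r)]
  exact AddMonoidAlgebra.sum_coeff_single N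

open Classical in
/-- A formal expression vanishes only if, for each exponent, the coefficients add up to zero. -/
theorem exists_of_expSum_ne_zero [IsFractionRing (MvPolynomial σ ℤ) K] {k : ℕ}
    {f g h : Fin k → MvPolynomial σ ℤ} (hh : ∀ i, h i ≠ 0) (h0 : expSum K f g h ≠ 0) :
    ∃ i₀, ∑ i with g i * h i₀ = g i₀ * h i, f i ≠ 0 := by
  contrapose! h0
  ext1
  ext1 r
  simp only [expSum, AddMonoidAlgebra.coeff_sum, AddMonoidAlgebra.coeff_single,
    AddMonoidAlgebra.coeff_zero, Finsupp.coe_zero, Pi.zero_apply, Finsupp.coe_finsetSum,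
    Finset.sum_apply, Finsupp.single_apply]
  rw [← Finset.sum_filter]
  by_cases hr : ∃ i₀, algebraMap (MvPolynomial σ ℤ) K (g i₀) / algebraMap _ K (h i₀) = r
  · obtain ⟨i₀, rfl⟩ := hr
    rw [← h0 i₀]
    refine Finset.sum_congr (Finset.filter_congr fun i _ => ?_) fun _ _ => rfl
    have hK : ∀ i, algebraMap (MvPolynomial σ ℤ) K (h i) ≠ 0 := fun i =>
      (map_ne_zero_iff _ (IsFractionRing.injective _ K)).2 (hh i)
    rw [div_eq_div_iff (hK _) (hK _), ← map_mul, ← map_mul,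
      (IsFractionRing.injective (MvPolynomial σ ℤ) K).eq_iff]
  · push Not at hr
    exact Finset.sum_eq_zero fun i hi => absurd (Finset.mem_filter.1 hi).2 (hr i)

variable {K} [IsFractionRing (MvPolynomial σ ℤ) K]
  {L : Type} [Field L] [Algebra (AddMonoidAlgebra (MvPolynomial σ ℤ) K) L]

variable (σ L) in
/-- The formal exponential of a rational function. -/
def formalExp (r : K) : L :=
  algebraMap (AddMonoidAlgebra (MvPolynomial σ ℤ) K) L (AddMonoidAlgebra.single r 1)

/-- The formal value of an output entry of a graph: an element of the field `L` of fractions of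
formal expressions. -/
def Graph.formalRun {l : ℕ} {Γ Δ : List Shape} (K L : Type) [Field K]
    [Algebra (MvPolynomial (Entry Γ) ℤ) K] [Field L]
    [Algebra (AddMonoidAlgebra (MvPolynomial (Entry Γ) ℤ) K) L] (G : Graph l Γ Δ)
    (e : Entry Δ) : Option L :=
  G.pairRun (formalExp (Entry Γ) L)
    (fun i => algebraMap (AddMonoidAlgebra (MvPolynomial (Entry Γ) ℤ) K) L
      (AddMonoidAlgebra.single 0 (X i)))
    (fun i => algebraMap (MvPolynomial (Entry Γ) ℤ) K (X i)) e

/-- The value of an output entry of a graph at a point. -/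
def Graph.pointRun {F₁ F₂ : Type} [Field F₁] [Field F₂] {l : ℕ} {Γ Δ : List Shape}
    (G : Graph l Γ Δ) (pt : Point (Entry Γ) F₁ F₂) (e : Entry Δ) : Option F₁ :=
  G.pairRun pt.char pt.fst pt.snd e

namespace Point

variable {F₁ F₂ : Type} [Field F₁] [Field F₂] (pt : Point σ F₁ F₂)

/-- Evaluation of a formal expression at a point. -/
def expSumEval {k : ℕ} (f g h : Fin k → MvPolynomial σ ℤ) : F₁ :=
  ∑ i, aeval pt.fst (f i) * pt.char (aeval pt.snd (g i) / aeval pt.snd (h i))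

variable (K) in
/-- Evaluation of rational functions at a point, for use in exponents. -/
def expPlace : Place K F₂ :=
  Place.ofHom (algebraMap (MvPolynomial σ ℤ) K) (IsFractionRing.injective _ K)
    (aeval pt.snd : MvPolynomial σ ℤ →ₐ[ℤ] F₂).toRingHom

theorem expPlace_div (g : MvPolynomial σ ℤ) {h : MvPolynomial σ ℤ} (hh : aeval pt.snd h ≠ 0) :
    (pt.expPlace K).Spec (algebraMap _ K g / algebraMap _ K h)
      (aeval pt.snd g / aeval pt.snd h) :=
  Place.ofHom_spec_iff.2 ⟨g, h, hh, rfl, rfl⟩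

variable (K) in
/-- The formal expressions all of whose exponents are defined at the point, as a part of all
formal expressions. -/
def incl : AddMonoidAlgebra (MvPolynomial σ ℤ) (pt.expPlace K).ring →+*
    AddMonoidAlgebra (MvPolynomial σ ℤ) K :=
  AddMonoidAlgebra.mapDomainRingHom _ (pt.expPlace K).ring.subtype.toAddMonoidHom

theorem incl_injective : Function.Injective (pt.incl K) :=
  AddMonoidAlgebra.mapDomain_injective Subtype.val_injective

theorem incl_single (r : (pt.expPlace K).ring) (f : MvPolynomial σ ℤ) :
    pt.incl K (AddMonoidAlgebra.single r f) = AddMonoidAlgebra.single (r : K) f :=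
  AddMonoidAlgebra.mapDomain_single

variable (K) in
/-- Evaluation at the point of the formal expressions all of whose exponents are defined there. -/
def evalHom : AddMonoidAlgebra (MvPolynomial σ ℤ) (pt.expPlace K).ring →+* F₁ :=
  AddMonoidAlgebra.liftNCRingHom (aeval pt.fst : MvPolynomial σ ℤ →ₐ[ℤ] F₁).toRingHom
    (pt.char.toMonoidHom.comp (AddMonoidHom.toMultiplicative (pt.expPlace K).ev.toAddMonoidHom))
    fun _ _ => Commute.all _ _

theorem evalHom_single (r : (pt.expPlace K).ring) (f : MvPolynomial σ ℤ) :
    pt.evalHom K (AddMonoidAlgebra.single r f) =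
      aeval pt.fst f * pt.char ((pt.expPlace K).ev r) :=
  AddMonoidAlgebra.liftNCRingHom_single _ _ _ _ _

theorem exists_incl_eq_expSum {k : ℕ} (f g h : Fin k → MvPolynomial σ ℤ)
    (hh : ∀ i, aeval pt.snd (h i) ≠ 0) :
    ∃ n, pt.incl K n = expSum K f g h ∧ pt.evalHom K n = pt.expSumEval f g h := by
  choose hm he using fun i => pt.expPlace_div (K := K) (g i) (hh i)
  refine ⟨∑ i, AddMonoidAlgebra.single ⟨_, hm i⟩ (f i), ?_, ?_⟩
  · simp only [map_sum, incl_single, expSum]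
  · simp only [map_sum, evalHom_single, expSumEval, he]

variable [IsFractionRing (AddMonoidAlgebra (MvPolynomial σ ℤ) K) L]

variable (K L) in
/-- Evaluation of fractions of formal expressions at a point. -/
def valPlace : Place L F₁ :=
  Place.ofHom ((algebraMap (AddMonoidAlgebra (MvPolynomial σ ℤ) K) L).comp (pt.incl K))
    ((IsFractionRing.injective _ L).comp pt.incl_injective) (pt.evalHom K)

theorem valPlace_incl (n) :
    (pt.valPlace K L).Spec (algebraMap _ L (pt.incl K n)) (pt.evalHom K n) :=
  Place.ofHom_spec n

theorem valPlace_expSum {k : ℕ} (f g h : Fin k → MvPolynomial σ ℤ)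
    (hh : ∀ i, aeval pt.snd (h i) ≠ 0) :
    (pt.valPlace K L).Spec (algebraMap _ L (expSum K f g h)) (pt.expSumEval f g h) := by
  obtain ⟨n, hn, he⟩ := pt.exists_incl_eq_expSum (K := K) f g h hh
  rw [← hn, ← he]
  exact pt.valPlace_incl n

theorem valPlace_X (i : σ) : (pt.valPlace K L).Spec
    (algebraMap (AddMonoidAlgebra (MvPolynomial σ ℤ) K) L (AddMonoidAlgebra.single 0 (X i)))
    (pt.fst i) := by
  have := pt.valPlace_incl (K := K) (L := L) (AddMonoidAlgebra.single 0 (X i))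
  rw [incl_single, evalHom_single] at this
  simpa using this

theorem expPlace_X (i : σ) :
    (pt.expPlace K).Spec (algebraMap (MvPolynomial σ ℤ) K (X i)) (pt.snd i) := by
  have := pt.expPlace_div (K := K) (X i) (h := 1) (by simp)
  simpa using this

theorem valPlace_formalExp (r : K) (a : F₂) (h : (pt.expPlace K).Spec r a) :
    (pt.valPlace K L).Spec (formalExp σ L r) (pt.char a) := by
  obtain ⟨h, rfl⟩ := h
  have := pt.valPlace_incl (K := K) (L := L) (AddMonoidAlgebra.single ⟨r, h⟩ 1)
  rw [incl_single, evalHom_single] at this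
  simpa [formalExp] using this

/-- If a fraction with value zero at the point has a denominator that need not be defined
there, and a numerator that is, then the numerator has the value zero. -/
theorem evalHom_eq_zero {l : L} (hl : (pt.valPlace K L).Spec l 0)
    {D : AddMonoidAlgebra (MvPolynomial σ ℤ) K}
    {n : AddMonoidAlgebra (MvPolynomial σ ℤ) (pt.expPlace K).ring}
    (h : l * algebraMap _ L D = algebraMap _ L (pt.incl K n)) : pt.evalHom K n = 0 := by
  obtain ⟨a, b, hb, rfl, h0⟩ := Place.ofHom_spec_iff.1 hl
  have ha : pt.evalHom K a = 0 := by
    rcases div_eq_zero_iff.1 h0.symm with h | h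
    · exact h
    · exact absurd h hb
  -- The part of a formal expression with exponents that are defined at the point.
  let π := AddMonoidAlgebra.comapDomainAddMonoidHom (R := MvPolynomial σ ℤ)
    (Subtype.val : (pt.expPlace K).ring → K) Subtype.val_injective
  have hπ_single : ∀ (r : (pt.expPlace K).ring) f,
      π (AddMonoidAlgebra.single (r : K) f) = AddMonoidAlgebra.single r f := fun r f =>
    AddMonoidAlgebra.comapDomain_single_map _ Subtype.val_injective r f
  have hπ_not : ∀ (r : K) f, r ∉ (pt.expPlace K).ring →
      π (AddMonoidAlgebra.single r f) = 0 := fun r f hr => by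
    ext t
    have hrt : r ≠ t := fun h => hr (h ▸ t.2)
    simp [π, hrt]
  have hπ : ∀ c d, π (pt.incl K c * d) = c * π d := by
    intro c d
    induction c using AddMonoidAlgebra.induction_linear with
    | zero => simp
    | add x y hx hy => rw [map_add, add_mul, map_add, hx, hy, add_mul]
    | single r f =>
      induction d using AddMonoidAlgebra.induction_linear with
      | zero => simp
      | add x y hx hy => rw [mul_add, map_add, hx, hy, map_add, mul_add]
      | single s f' =>
        rw [incl_single, AddMonoidAlgebra.single_mul_single]
        by_cases hs : s ∈ (pt.expPlace K).ring
        · lift s to (pt.expPlace K).ring using hs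
          rw [hπ_single, AddMonoidAlgebra.single_mul_single, ← hπ_single]
          rfl
        · rw [hπ_not s _ hs, mul_zero, hπ_not]
          intro hrs
          exact hs (by simpa using (pt.expPlace K).ring.sub_mem hrs r.2)
  have hπ_incl : ∀ c, π (pt.incl K c) = c := by
    intro c
    have := hπ c (AddMonoidAlgebra.single ((0 : (pt.expPlace K).ring) : K) 1)
    rw [hπ_single] at this
    simpa [← AddMonoidAlgebra.one_def] using this
  have hbL : (algebraMap (AddMonoidAlgebra (MvPolynomial σ ℤ) K) L) (pt.incl K b) ≠ 0 := by
    rw [map_ne_zero_iff _ (IsFractionRing.injective _ L),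
      map_ne_zero_iff _ pt.incl_injective]
    rintro rfl
    exact hb (map_zero _)
  have key : pt.incl K a * D = pt.incl K (b * n) := by
    apply IsFractionRing.injective (AddMonoidAlgebra (MvPolynomial σ ℤ) K) L
    rw [map_mul, map_mul, map_mul, ← h]
    simp only [RingHom.comp_apply]
    field_simp
  have key' := congrArg (fun x => pt.evalHom K (π x)) key
  simp only [hπ, hπ_incl, map_mul, ha, zero_mul] at key'
  exact (mul_eq_zero.1 key'.symm).resolve_left hb

/-- The comparison of the value of a graph at a point with its formal value. -/
theorem exists_spec {l : ℕ} {Γ Δ : List Shape} {K L : Type} [Field K]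
    [Algebra (MvPolynomial (Entry Γ) ℤ) K] [IsFractionRing (MvPolynomial (Entry Γ) ℤ) K] [Field L]
    [Algebra (AddMonoidAlgebra (MvPolynomial (Entry Γ) ℤ) K) L]
    [IsFractionRing (AddMonoidAlgebra (MvPolynomial (Entry Γ) ℤ) K) L]
    (pt : Point (Entry Γ) F₁ F₂) (G : Graph l Γ Δ) (e : Entry Δ) {a : F₁}
    (ha : G.pointRun pt e = some a) :
    ∃ r, G.formalRun K L e = some r ∧ (pt.valPlace K L).Spec r a :=
  G.exists_spec_of_pairRun pt.valPlace_formalExp pt.valPlace_X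
    (pt.expPlace_X) e ha

end Point

section Families

variable {X : Type} {F₁ F₂ : X → Type} [∀ x, Field (F₁ x)] [∀ x, Field (F₂ x)]

/-- A family of points is generic along a filter if each formal expression that is not zero has a
nonzero value at almost all of the points. -/
def GenericPoints (K : Type) [Field K] [Algebra (MvPolynomial σ ℤ) K] (𝓕 : Filter X)
    (pt : ∀ x, Point σ (F₁ x) (F₂ x)) : Prop :=
  ∀ (k : ℕ) (f g h : Fin k → MvPolynomial σ ℤ), (∀ i, h i ≠ 0) → expSum K f g h ≠ 0 →
    ∀ᶠ x in 𝓕, (∀ i, aeval (pt x).snd (h i) ≠ 0) ∧ (pt x).expSumEval f g h ≠ 0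

namespace GenericPoints

variable {𝓕 : Filter X} {pt : ∀ x, Point σ (F₁ x) (F₂ x)}

omit [IsFractionRing (MvPolynomial σ ℤ) K] in
theorem snd_ne_zero (hpt : GenericPoints K 𝓕 pt) {h : MvPolynomial σ ℤ} (hh : h ≠ 0) :
    ∀ᶠ x in 𝓕, aeval (pt x).snd h ≠ 0 :=
  (hpt 1 1 0 (fun _ => h) (fun _ => hh) (by simp [expSum])).mono fun x hx => hx.1 0

theorem expPlace (hpt : GenericPoints K 𝓕 pt) :
    GenericPlaces 𝓕 fun x => (pt x).expPlace K := by
  intro r hr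
  obtain ⟨g, h, hh, rfl⟩ := IsFractionRing.div_surjective (A := MvPolynomial σ ℤ) r
  have hg : g ≠ 0 := by
    rintro rfl
    simp at hr
  filter_upwards [hpt.snd_ne_zero hg, hpt.snd_ne_zero (nonZeroDivisors.ne_zero hh)] with x h1 h2
  exact ⟨_, div_ne_zero h1 h2, (pt x).expPlace_div g h2⟩

variable [IsFractionRing (AddMonoidAlgebra (MvPolynomial σ ℤ) K) L]

theorem valPlace (hpt : GenericPoints K 𝓕 pt) :
    GenericPlaces 𝓕 fun x => (pt x).valPlace K L := by
  intro r hr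
  have key : ∀ N : AddMonoidAlgebra (MvPolynomial σ ℤ) K, N ≠ 0 →
      ∀ᶠ x in 𝓕, ∃ a, a ≠ 0 ∧ ((pt x).valPlace K L).Spec (algebraMap _ L N) a := by
    intro N hN
    obtain ⟨k, f, g, h, hh, rfl⟩ := exists_expSum_eq K N
    filter_upwards [hpt k f g h hh hN] with x hx
    exact ⟨_, hx.2, (pt x).valPlace_expSum f g h hx.1⟩
  obtain ⟨N, D, hD, rfl⟩ := IsFractionRing.div_surjective
    (A := AddMonoidAlgebra (MvPolynomial σ ℤ) K) r
  have hN : N ≠ 0 := by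
    rintro rfl
    simp at hr
  have hD0 : D ≠ 0 := by
    rintro rfl
    simp at hr
  filter_upwards [key N hN, key D hD0] with x ⟨a, ha, ha'⟩ ⟨b, hb, hb'⟩
  exact ⟨_, div_ne_zero ha hb, ha'.div hb' hb⟩

end GenericPoints

/-- The comparison of the formal value of a graph with its values at the points of a generic
family. -/
theorem GenericPoints.eventually_pointRun {l : ℕ} {Γ Δ : List Shape} {K L : Type} [Field K]
    [Algebra (MvPolynomial (Entry Γ) ℤ) K] [IsFractionRing (MvPolynomial (Entry Γ) ℤ) K] [Field L]
    [Algebra (AddMonoidAlgebra (MvPolynomial (Entry Γ) ℤ) K) L]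
    [IsFractionRing (AddMonoidAlgebra (MvPolynomial (Entry Γ) ℤ) K) L]
    {𝓕 : Filter X} {pt : ∀ x, Point (Entry Γ) (F₁ x) (F₂ x)} (hpt : GenericPoints K 𝓕 pt)
    (G : Graph l Γ Δ) (e : Entry Δ) {r : L} (hr : G.formalRun K L e = some r) :
    ∀ᶠ x in 𝓕, ∃ a, ((pt x).valPlace K L).Spec r a ∧ G.pointRun (pt x) e = some a :=
  G.eventually_pairRun hpt.expPlace hpt.valPlace (fun x => (pt x).valPlace_formalExp)
    (fun x => (pt x).valPlace_X) (fun x => (pt x).expPlace_X) e hr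

end Families

end Formal

/-! ### Real and rational points -/

/-- The inclusion of a subfield, read backwards as a place. -/
def Place.ofField {F L : Type} [Field F] [Field L] (c : F →+* L) : Place L F :=
  Place.ofHom c c.injective (RingHom.id F)

theorem Place.ofField_spec_iff {F L : Type} [Field F] [Field L] {c : F →+* L} {l : L} {a : F} :
    (Place.ofField c).Spec l a ↔ l = c a := by
  refine ⟨fun h => ?_, ?_⟩
  · obtain ⟨n, d, -, rfl, rfl⟩ := Place.ofHom_spec_iff.1 h
    simp
  · rintro rfl
    exact Place.ofHom_spec (ev := RingHom.id F) a

/-- The real point with coordinates in a field `F` that is embedded in the real numbers. Inside of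
exponents, the coordinates are elements of `F`. -/
def realPoint {σ F : Type} [Field F] (c : F →+* ℝ) (x : σ → F) : Point σ ℝ F where
  fst i := c (x i)
  snd := x
  char :=
    { toFun a := Real.exp (c a)
      map_zero_eq_one' := by simp
      map_add_eq_mul' a b := by simp [Real.exp_add] }

section Real

variable {l : ℕ} {Γ Δ : List Shape} {F : Type} [Field F] (c : F →+* ℝ)

/-- Pair interpretations only differ from the evaluation over the real numbers by being
defined less often. -/
theorem Graph.realRun_eq_some_of_pointRun (G : Graph l Γ Δ) (x : Entry Γ → F) (e : Entry Δ) {a : ℝ}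
    (h : G.pointRun (realPoint c x) e = some a) : G.realRun (fun i => c (x i)) e = some a := by
  have key := (Graph.run_rel (I := pairInterp (realPoint c x).char) (J := realInterp)
    (R := fun v w => (∀ a, v.1 = some a → ∃ b, w = some b ∧
        (Place.ofField (RingHom.id ℝ)).Spec b a) ∧
      (∀ a, v.2 = some a → ∃ b, w = some b ∧ (Place.ofField c).Spec b a))
    ⟨fun _ h => h, ?_, ?_, ?_, ?_⟩ G (x := fun i => (some (c (x i)), some (x i)))
    (y := fun i => some (c (x i))) (fun i => ⟨?_, ?_⟩) e).1 a h
  · obtain ⟨b, hb, hs⟩ := key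
    rw [Place.ofField_spec_iff] at hs
    subst hs
    exact hb
  · exact fun f X Y h o => ⟨multilinearOpt_specialize (fun i j => (h i j).1) o,
      multilinearOpt_specialize (fun i j => (h i j).2) o⟩
  · exact fun x y h => ⟨sumOpt_specialize fun i => (h i).1, sumOpt_specialize fun i => (h i).2⟩
  · exact fun h h' => ⟨divOpt_specialize h.1 h'.1, divOpt_specialize h.2 h'.2⟩
  · rintro _ v w ⟨-, h⟩
    refine ⟨fun a ha => ?_, fun a ha => by simp [pairInterp] at ha⟩
    obtain ⟨b, hb, rfl⟩ := Option.map_eq_some_iff.1 ha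
    obtain ⟨r, rfl, hs⟩ := h b hb
    rw [Place.ofField_spec_iff] at hs
    subst hs
    exact ⟨_, rfl, Place.ofField_spec_iff.2 rfl⟩
  · rintro _ ⟨⟩
    exact ⟨_, rfl, Place.ofField_spec_iff.2 rfl⟩
  · rintro _ ⟨⟩
    exact ⟨_, rfl, Place.ofField_spec_iff.2 rfl⟩

/-- The evaluation of a Lax graph over the real numbers never exponentiates the result of an
exponentiation. -/
theorem Graph.IsLax.pointRun_eq_some {G : Graph l Γ Δ} (hG : G.IsLax) (x : Entry Γ → ℝ)
    (e : Entry Δ) {a : ℝ} (h : G.realRun x e = some a) :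
    G.pointRun (realPoint (RingHom.id ℝ) x) e = some a := by
  let P := Place.ofField (RingHom.id ℝ)
  have key := (hG.run_rel (I := realInterp) (J := pairInterp (realPoint (RingHom.id ℝ) x).char)
    (R := fun n v w => (n ≤ 1 → ∀ a, v = some a → ∃ b, w.1 = some b ∧ P.Spec b a) ∧
      (n ≤ 0 → ∀ a, v = some a → ∃ b, w.2 = some b ∧ P.Spec b a))
    ⟨fun hmn h => ⟨fun hn => h.1 (hmn.trans hn), fun hn => h.2 (hmn.trans hn)⟩, ?_, ?_, ?_, ?_⟩
    (x := fun i => some (x i)) (y := fun i => (some (x i), some (x i)))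
    (fun i => ⟨fun _ => ?_, fun _ => ?_⟩) e).1 le_rfl a h
  · obtain ⟨b, hb, hs⟩ := key
    rw [Place.ofField_spec_iff] at hs
    subst hs
    exact hb
  · exact fun f X Y h o => ⟨fun hn => multilinearOpt_specialize (fun i j => (h i j).1 hn) o,
      fun hn => multilinearOpt_specialize (fun i j => (h i j).2 hn) o⟩
  · exact fun x y h => ⟨fun hn => sumOpt_specialize fun i => (h i).1 hn,
      fun hn => sumOpt_specialize fun i => (h i).2 hn⟩
  · exact fun h h' => ⟨fun hn => divOpt_specialize (h.1 hn) (h'.1 hn),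
      fun hn => divOpt_specialize (h.2 hn) (h'.2 hn)⟩
  · rintro n v w ⟨-, h⟩
    refine ⟨fun hn a ha => ?_, fun hn => by omega⟩
    obtain ⟨b, hb, rfl⟩ := Option.map_eq_some_iff.1 ha
    obtain ⟨r, hr, hs⟩ := h (by omega) b hb
    rw [Place.ofField_spec_iff] at hs
    subst hs
    exact ⟨Real.exp r, by simp [pairInterp, hr, realPoint], Place.ofField_spec_iff.2 rfl⟩
  · rintro _ ⟨⟩
    exact ⟨_, rfl, Place.ofField_spec_iff.2 rfl⟩
  · rintro _ ⟨⟩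
    exact ⟨_, rfl, Place.ofField_spec_iff.2 rfl⟩

end Real

/-- The filter of the sets of rational points that contain the complement of a hypersurface. -/
def zariskiFilter (σ : Type) : Filter (σ → ℚ) where
  sets := {S | ∃ g : MvPolynomial σ ℤ, g ≠ 0 ∧ ∀ x : σ → ℚ, aeval x g ≠ 0 → x ∈ S}
  univ_sets := ⟨1, one_ne_zero, fun _ _ => trivial⟩
  sets_of_superset := fun ⟨g, hg, h⟩ hST => ⟨g, hg, fun x hx => hST (h x hx)⟩
  inter_sets := fun ⟨g, hg, h⟩ ⟨g', hg', h'⟩ => ⟨g * g', mul_ne_zero hg hg', fun x hx => by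
    rw [map_mul] at hx
    exact ⟨h x (left_ne_zero_of_mul hx), h' x (right_ne_zero_of_mul hx)⟩⟩

theorem eventually_zariskiFilter {σ : Type} {g : MvPolynomial σ ℤ} (hg : g ≠ 0) :
    ∀ᶠ x in zariskiFilter σ, aeval x g ≠ 0 :=
  ⟨g, hg, fun _ hx => hx⟩

instance (σ : Type) : (zariskiFilter σ).NeBot := by
  rw [neBot_iff]
  intro hbot
  have hmem : ∅ ∈ zariskiFilter σ := by
    rw [hbot]
    exact mem_bot
  obtain ⟨g, hg, h⟩ := hmem
  apply hg
  apply MvPolynomial.map_injective (Int.castRingHom ℚ) Int.cast_injective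
  rw [map_zero]
  refine MvPolynomial.funext fun x => ?_
  rw [map_zero, eval_map]
  by_contra hx
  exact h x hx

/-- Away from a hypersurface, different exponents have different rational values, so that the linear
independence of the exponentials of rational numbers applies. -/
theorem genericPoints_rational {σ : Type} (K : Type) [Field K] [Algebra (MvPolynomial σ ℤ) K]
    [IsFractionRing (MvPolynomial σ ℤ) K] :
    GenericPoints K (zariskiFilter σ) fun x => realPoint (Rat.castHom ℝ) x := by
  classical
  intro k f g h hh h0
  obtain ⟨i₀, hF⟩ := exists_of_expSum_ne_zero K hh h0
  have h2 : ∀ i, ∀ᶠ x : σ → ℚ in zariskiFilter σ,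
      g i * h i₀ ≠ g i₀ * h i → aeval x (g i * h i₀) ≠ aeval x (g i₀ * h i) := by
    intro i
    by_cases hi : g i * h i₀ = g i₀ * h i
    · exact Eventually.of_forall fun x hx => absurd hi hx
    · filter_upwards [eventually_zariskiFilter (sub_ne_zero.2 hi)] with x hx _
      rwa [map_sub, sub_ne_zero] at hx
  filter_upwards [eventually_all.2 fun i => eventually_zariskiFilter (hh i),
    eventually_all.2 h2, eventually_zariskiFilter hF] with x h1 h2 h3
  refine ⟨h1, fun hsum => h3 ?_⟩
  have hc : ∀ F : MvPolynomial σ ℤ, aeval (realPoint (Rat.castHom ℝ) x).fst F =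
      ((aeval x F : ℚ) : ℝ) := fun F => by
    have := (aeval_algebraMap_apply ℝ x F)
    simpa [realPoint, Function.comp_def] using this
  have := sum_filter_eq_zero_of_sum_exp (fun i => aeval x (f i))
    (fun i => aeval x (g i) / aeval x (h i)) (by
      simp only [← hc]
      rw [← hsum]
      simp [Point.expSumEval, realPoint]) i₀
  rw [map_sum, ← this]
  refine Finset.sum_congr (Finset.filter_congr fun i _ => ?_) fun _ _ => rfl
  rw [div_eq_div_iff (h1 _) (h1 _), ← map_mul, ← map_mul]
  exact ⟨fun h => by rw [h], fun h => by_contra fun hne => h2 i hne h⟩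

/-! ### Uniform probabilities -/

section Probability

variable {Ω α β : Type} [Finite Ω] [Finite α] [Finite β]

omit [Finite Ω] in
theorem uniformProb_univ (E : Set Ω) :
    uniformProb Set.univ E = (E.ncard : ℝ) / (Nat.card Ω : ℝ) := by
  rw [uniformProb, Set.univ_inter, Set.ncard_univ]

theorem uniformProb_univ_mono {E E' : Set Ω} (h : E ⊆ E') :
    uniformProb Set.univ E ≤ uniformProb Set.univ E' := by
  rw [uniformProb_univ, uniformProb_univ]
  have := Set.ncard_le_ncard h
  gcongr

omit [Finite Ω] in
theorem uniformProb_nonneg (S E : Set Ω) : 0 ≤ uniformProb S E := by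
  unfold uniformProb
  positivity

omit [Finite Ω] in
theorem uniformProb_univ_union_le (E E' : Set Ω) :
    uniformProb Set.univ (E ∪ E') ≤ uniformProb Set.univ E + uniformProb Set.univ E' := by
  rw [uniformProb_univ, uniformProb_univ, uniformProb_univ, ← add_div]
  have := Set.ncard_union_le E E'
  gcongr
  exact_mod_cast this

omit [Finite Ω] in
theorem uniformProb_univ_iUnion_le {k : ℕ} (E : Fin k → Set Ω) {c : ℝ}
    (h : ∀ i, uniformProb Set.univ (E i) ≤ c) : uniformProb Set.univ (⋃ i, E i) ≤ k * c := by
  induction k with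
  | zero => simp [uniformProb_univ]
  | succ k ih =>
    have h1 : (⋃ i, E i) = E 0 ∪ ⋃ i : Fin k, E i.succ := by
      ext x
      simp [Fin.exists_fin_succ]
    rw [h1]
    have h2 := uniformProb_univ_union_le (E 0) (⋃ i : Fin k, E i.succ)
    have h3 := ih (fun i => E i.succ) fun i => h _
    have h4 := h 0
    push_cast
    linarith

/-- If the conditional probability is at most `c` for each value of the first component, then the
probability is at most `c`. -/
theorem uniformProb_univ_prod_le {E : Set (α × β)} {c : ℝ} (hc : 0 ≤ c)
    (h : ∀ a, uniformProb Set.univ {b | (a, b) ∈ E} ≤ c) : uniformProb Set.univ E ≤ c := by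
  classical
  have := Fintype.ofFinite α
  have h1 : (E.ncard : ℝ) = ∑ a, (({b | (a, b) ∈ E} : Set β).ncard : ℝ) := by
    have e : E ≃ Σ a, ({b | (a, b) ∈ E} : Set β) :=
      { toFun x := ⟨x.1.1, x.1.2, x.2⟩
        invFun x := ⟨(x.1, x.2.1), x.2.2⟩
        left_inv _ := rfl
        right_inv _ := rfl }
    rw [← Nat.card_coe_set_eq, Nat.card_congr e, Nat.card_sigma]
    push_cast
    rfl
  rw [uniformProb_univ, h1, Nat.card_prod, Nat.card_eq_fintype_card (α := α)]
  rcases eq_or_ne (Nat.card β) 0 with h0 | h0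
  · simpa [h0] using hc
  have hβ : (0 : ℝ) < Nat.card β := by positivity
  refine div_le_of_le_mul₀ (by positivity) hc ?_
  calc _ ≤ ∑ a : α, c * (Nat.card β : ℝ) := by
        refine Finset.sum_le_sum fun a _ => ?_
        have := h a
        rwa [uniformProb_univ, div_le_iff₀ hβ] at this
    _ = _ := by
        rw [Finset.sum_const, Finset.card_univ, nsmul_eq_mul]
        push_cast
        ring

theorem uniformProb_univ_snd_le {E : Set β} {c : ℝ} (hc : 0 ≤ c)
    (h : uniformProb Set.univ E ≤ c) :
    uniformProb Set.univ {s : α × β | s.2 ∈ E} ≤ c :=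
  uniformProb_univ_prod_le hc fun _ => h

theorem uniformProb_univ_fst_le {E : Set α} {c : ℝ} (hc : 0 ≤ c)
    (h : uniformProb Set.univ E ≤ c) :
    uniformProb Set.univ {s : α × β | s.1 ∈ E} ≤ c := by
  have h1 : uniformProb Set.univ {s : β × α | s.2 ∈ E} ≤ c :=
    uniformProb_univ_snd_le hc h
  have h2 : ({s : α × β | s.1 ∈ E} : Set _).ncard = ({s : β × α | s.2 ∈ E} : Set _).ncard :=
    Set.ncard_congr' ((Equiv.prodComm α β).subtypeEquiv fun _ => Iff.rfl)
  rw [uniformProb_univ] at h1 ⊢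
  rwa [h2, Nat.card_prod, mul_comm, ← Nat.card_prod]

omit [Finite Ω] in
theorem ncard_forall_mem (T : ℕ) (S : Set Ω) :
    ({s : Fin T → Ω | ∀ t, s t ∈ S} : Set _).ncard = S.ncard ^ T := by
  rw [← Nat.card_coe_set_eq, ← Nat.card_coe_set_eq S]
  refine (Nat.card_congr (Equiv.subtypePiEquivPi (p := fun _ x => x ∈ S))).trans ?_
  rw [Nat.card_pi]
  simp

omit [Finite Ω] in
/-- The probability that independent events all occur. -/
theorem uniformProb_forall (T : ℕ) (S E : Set Ω) :
    uniformProb {s : Fin T → Ω | ∀ t, s t ∈ S} {s | ∀ t, s t ∈ E} = uniformProb S E ^ T := by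
  have : {s : Fin T → Ω | ∀ t, s t ∈ S} ∩ {s | ∀ t, s t ∈ E} = {s | ∀ t, s t ∈ S ∩ E} := by
    ext s
    simp [forall_and]
  rw [uniformProb, this, ncard_forall_mem, ncard_forall_mem, uniformProb, div_pow]
  push_cast
  rfl

end Probability

/-! ### Zeros of polynomials over finite fields -/

section Polynomials

variable {σ : Type}

/-- The Schwartz–Zippel lemma for the reduction of an integral polynomial. -/
theorem uniformProb_aeval_eq_zero_le [Finite σ] {F : Type} [Field F] [Finite F]
    {f : MvPolynomial σ ℤ} (hf : MvPolynomial.map (Int.castRingHom F) f ≠ 0) {d : ℕ}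
    (hd : f.totalDegree ≤ d) :
    uniformProb Set.univ {x : σ → F | aeval x f = 0} ≤ d / (Nat.card F : ℝ) := by
  classical
  have := Fintype.ofFinite σ
  have := Fintype.ofFinite F
  let e := Fintype.equivFin σ
  let P : MvPolynomial (Fin (Fintype.card σ)) F := rename e (MvPolynomial.map (Int.castRingHom F) f)
  have hP : P ≠ 0 := by
    rw [← map_zero (rename (R := F) e)]
    exact (rename_injective e e.injective).ne hf
  have hPd : P.totalDegree ≤ d :=
    (totalDegree_rename_le _ _).trans ((Finset.sup_mono (support_map_subset _ _)).trans hd)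
  have hSZ := schwartz_zippel_totalDegree hP (Finset.univ : Finset F)
  have heval : ∀ x : Fin (Fintype.card σ) → F, eval x P = aeval (x ∘ e) f := by
    intro x
    simp only [P, eval_rename, eval_map]
    rfl
  have hcard : ({x : σ → F | aeval x f = 0} : Set _).ncard =
      (Finset.filter (fun x => eval x P = 0)
        (Fintype.piFinset fun _ : Fin (Fintype.card σ) => (Finset.univ : Finset F))).card := by
    rw [← Set.ncard_coe_finset]
    refine (Set.ncard_congr' ((Equiv.arrowCongr e (Equiv.refl F)).subtypeEquiv fun x => ?_))
    have hx : (Equiv.arrowCongr e (Equiv.refl F)) x ∘ e = x := by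
      ext i
      simp
    simp [heval, hx]
  rw [uniformProb_univ, hcard, Nat.card_fun, Nat.card_eq_fintype_card, Nat.card_eq_fintype_card]
  rw [Finset.card_univ] at hSZ
  have hSZ' := (NNRat.cast_le (K := ℝ)).2 hSZ
  push_cast at hSZ' ⊢
  refine hSZ'.trans ?_
  gcongr

theorem map_castRingHom_ne_zero {f : MvPolynomial σ ℤ} (hf : f ≠ 0) {w p : ℕ}
    (hw : ∀ m, |f.coeff m| ≤ w) (hp : w < p) :
    MvPolynomial.map (Int.castRingHom (ZMod p)) f ≠ 0 := by
  obtain ⟨m, hm⟩ := ne_zero_iff.1 hf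
  refine ne_zero_iff.2 ⟨m, ?_⟩
  rw [coeff_map, eq_intCast, Ne, ZMod.intCast_zmod_eq_zero_iff_dvd]
  intro h
  have h1 := Int.le_of_dvd (abs_pos.2 hm) ((dvd_abs _ _).2 h)
  have h2 := hw m
  omega

theorem card_antidiagonal_le (m : σ →₀ ℕ) [DecidableEq σ] :
    (Finset.HasAntidiagonal.antidiagonal m).card ≤ 2 ^ (m.sum fun _ e => e) := by
  calc _ ≤ (Finset.Iic m).card := by
        refine Finset.card_le_card_of_injOn Prod.fst (fun x hx => ?_) fun x hx y hy h => ?_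
        · have := Finset.HasAntidiagonal.mem_antidiagonal.1 hx
          exact Finset.mem_coe.2 (Finset.mem_Iic.2 (this ▸ le_self_add))
        · have hx := Finset.HasAntidiagonal.mem_antidiagonal.1 hx
          have hy := Finset.HasAntidiagonal.mem_antidiagonal.1 hy
          refine Prod.ext h (add_left_cancel (a := x.1) ?_)
          rw [hx, h, hy]
    _ = ∏ i ∈ m.support, (Finset.Iic (m i)).card := Finsupp.card_Iic m
    _ ≤ ∏ i ∈ m.support, 2 ^ m i := Finset.prod_le_prod' fun i _ => by
        rw [Nat.card_Iic]
        exact Nat.lt_two_pow_self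
    _ = _ := Finset.prod_pow_eq_pow_sum _ _ _

/-- The coefficients of a product are bounded in terms of the degrees and coefficients of the
factors, for any number of variables. -/
theorem abs_coeff_mul_le {f g : MvPolynomial σ ℤ} {d w : ℕ} (hf : f.totalDegree ≤ d)
    (hg : g.totalDegree ≤ d) (hfw : ∀ m, |f.coeff m| ≤ w) (hgw : ∀ m, |g.coeff m| ≤ w)
    (m : σ →₀ ℕ) : |(f * g).coeff m| ≤ (2 ^ (2 * d) * (w * w) : ℕ) := by
  classical
  by_cases hm : (f * g).coeff m = 0
  · rw [hm, abs_zero]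
    positivity
  have hdeg : (m.sum fun _ e => e) ≤ 2 * d := by
    have h1 := le_totalDegree (mem_support_iff.2 hm)
    have h2 := totalDegree_mul f g
    omega
  rw [coeff_mul]
  calc _ ≤ ∑ x ∈ Finset.HasAntidiagonal.antidiagonal m, |f.coeff x.1 * g.coeff x.2| :=
        Finset.abs_sum_le_sum_abs _ _
    _ ≤ ∑ x ∈ Finset.HasAntidiagonal.antidiagonal m, ((w * w : ℕ) : ℤ) := by
        refine Finset.sum_le_sum fun x _ => ?_
        rw [abs_mul]
        push_cast
        exact mul_le_mul (hfw _) (hgw _) (abs_nonneg _) (by positivity)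
    _ = ((Finset.HasAntidiagonal.antidiagonal m).card * (w * w) : ℕ) := by
        rw [Finset.sum_const, nsmul_eq_mul]
        push_cast
        ring
    _ ≤ _ := by
        have := (card_antidiagonal_le m).trans (Nat.pow_le_pow_right (by norm_num) hdeg)
        exact_mod_cast Nat.mul_le_mul_right _ this

end Polynomials

/-! ### Sparse polynomials and roots of unity -/

section Sparse

theorem card_rootsOfUnity {p q : ℕ} [Fact p.Prime] [Fact q.Prime] (hpq : q ∣ p - 1) :
    Nat.card {ω : ZMod p // ω ^ q = 1} = q := by
  have hq : 0 < q := (Fact.out : q.Prime).pos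
  obtain ⟨u, hu⟩ := IsCyclic.exists_generator (α := (ZMod p)ˣ)
  have hord : orderOf u = p - 1 := by
    rw [orderOf_eq_card_of_forall_mem_zpowers hu, Nat.card_eq_fintype_card, ZMod.card_units]
  have hp1 : p - 1 ≠ 0 := by
    have := (Fact.out : p.Prime).two_le
    omega
  have h1 : orderOf (u ^ (orderOf u / q)) = q :=
    orderOf_pow_orderOf_div (by rwa [hord]) (by rwa [hord])
  have hprim : IsPrimitiveRoot ((u ^ (orderOf u / q) : (ZMod p)ˣ) : ZMod p) q := by
    have := IsPrimitiveRoot.orderOf (u ^ (orderOf u / q))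
    rw [h1] at this
    exact IsPrimitiveRoot.coe_units_iff.2 this
  refine Eq.trans ?_ hprim.card_nthRootsFinset
  rw [← Nat.card_eq_finsetCard]
  exact Nat.card_congr (Equiv.subtypeEquivRight fun x => by
    rw [Polynomial.mem_nthRootsFinset hq])

/-- Simultaneous approximation: finitely many residues can be multiplied by a unit such that
all of them get small representatives. -/
theorem exists_mul_small {q k m B : ℕ} [Fact q.Prime] (e : Fin k → ZMod q) (hB : B ^ k < q)
    (hm : q ≤ m * B) :
    ∃ u : ZMod q, u ≠ 0 ∧ ∃ n : ZMod q → ℕ, ∀ i, n (e i) ≤ 2 * m ∧ (n (e i) : ZMod q) =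
      u * e i + m := by
  have hm0 : 0 < m := by
    rcases Nat.eq_zero_or_pos m with rfl | h
    · have := (Fact.out : q.Prime).pos
      omega
    · exact h
  let box : ZMod q → Fin k → Fin B := fun s i =>
    ⟨(s * e i).val / m, Nat.div_lt_of_lt_mul ((ZMod.val_lt _).trans_le hm)⟩
  obtain ⟨s, s', hne, hbox⟩ := Fintype.exists_ne_map_eq_of_card_lt box (by simpa using hB)
  -- The representatives in one box differ by less than `m`; adding `m` makes the differences
  -- natural numbers.
  refine ⟨s - s', sub_ne_zero.2 hne, fun x => (s * x).val + m - (s' * x).val, fun i => ?_⟩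
  have h1 : (s * e i).val / m = (s' * e i).val / m :=
    congrArg Fin.val (congrFun hbox i)
  have h2 := Nat.div_add_mod (s * e i).val m
  have h3 := Nat.div_add_mod (s' * e i).val m
  have h4 := Nat.mod_lt (s * e i).val hm0
  have h5 := Nat.mod_lt (s' * e i).val hm0
  rw [h1] at h2
  dsimp only
  refine ⟨by omega, ?_⟩
  rw [Nat.cast_sub (by omega)]
  push_cast
  rw [ZMod.natCast_zmod_val, ZMod.natCast_zmod_val]
  ring

/-- A polynomial with few terms has few zeros among the `q`-th roots of unity. The roots of unity
are permuted by raising to a power prime to `q`, and a suitable such power makes the degree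
small. -/
theorem card_sparse_zeros_le {p q k m B : ℕ} [Fact p.Prime] [Fact q.Prime]
    (c : Fin k → ZMod p) (e : Fin k → ZMod q) (i₀ : Fin k) (hc : ∑ i with e i = e i₀, c i ≠ 0)
    (hB : B ^ k < q) (hm : q ≤ m * B) :
    ({ω | ∑ i, c i * ω.1 ^ (e i).val = 0} : Set {ω : ZMod p // ω ^ q = 1}).ncard ≤ 2 * m := by
  classical
  obtain ⟨u, hu, n, hn⟩ := exists_mul_small e hB hm
  let Q : Polynomial (ZMod p) := ∑ i, Polynomial.C (c i) * Polynomial.X ^ n (e i)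
  have hQ0 : Q ≠ 0 := by
    intro h
    apply hc
    have hcoeff := congrArg (fun Q : Polynomial (ZMod p) => Q.coeff (n (e i₀))) h
    simp only [Q, Polynomial.finsetSum_coeff, Polynomial.coeff_C_mul, Polynomial.coeff_X_pow,
      Polynomial.coeff_zero, mul_ite, mul_one, mul_zero] at hcoeff
    rw [← Finset.sum_filter] at hcoeff
    rw [← hcoeff]
    refine Finset.sum_congr (Finset.filter_congr fun i _ => ?_) fun _ _ => rfl
    refine ⟨fun h => by rw [h], fun h => ?_⟩
    have h' := congrArg (fun n : ℕ => (n : ZMod q)) h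
    rw [(hn i).2, (hn i₀).2, add_left_inj] at h'
    exact (mul_left_cancel₀ hu h').symm
  have hdeg : Q.natDegree ≤ 2 * m := by
    refine Polynomial.natDegree_sum_le_of_forall_le _ _ fun i _ => ?_
    exact (Polynomial.natDegree_C_mul_X_pow_le _ _).trans (hn i).1
  let χ (ω : {ω : ZMod p // ω ^ q = 1}) : AddChar (ZMod q) (ZMod p) := AddChar.zmodChar q ω.2
  have hχ : ∀ ω a, χ ω a = ω.1 ^ a.val := fun ω a => AddChar.zmodChar_apply ω.2 a
  have hχn : ∀ ω a (b : ℕ), χ ω a ^ b = χ ω (b * a) := by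
    intro ω a b
    rw [← AddChar.map_nsmul_eq_pow, nsmul_eq_mul]
  -- The zero `ω` corresponds to the root `ω ^ u⁻¹` of `Q`.
  refine (Set.ncard_le_ncard_of_injOn (t := (Q.roots.toFinset : Set (ZMod p)))
    (fun ω => χ ω u⁻¹) ?_ ?_).trans ?_
  · intro ω hω
    simp only [Finset.mem_coe, Multiset.mem_toFinset, Polynomial.mem_roots hQ0,
      Polynomial.IsRoot.def, Q, Polynomial.eval_finsetSum, Polynomial.eval_mul,
      Polynomial.eval_C, Polynomial.eval_pow, Polynomial.eval_X, hχn, (hn _).2]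
    have h1 : ∀ i, (u * e i + m) * u⁻¹ = e i + m * u⁻¹ := fun i => by field_simp
    simp only [h1, AddChar.map_add_eq_mul, ← mul_assoc]
    rw [← Finset.sum_mul]
    simp only [hχ]
    rw [hω.out, zero_mul]
  · intro ω _ ω' _ h
    have h1 : ∀ ω, χ ω u⁻¹ ^ u.val = ω.1 := by
      intro ω
      rw [hχn, ZMod.natCast_zmod_val, mul_inv_cancel₀ hu, hχ, ZMod.val_one, pow_one]
    apply Subtype.ext
    rw [← h1 ω, ← h1 ω']
    exact congrArg (· ^ u.val) h
  · rw [Set.ncard_coe_finset]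
    exact (Multiset.toFinset_card_le _).trans ((Polynomial.card_roots' Q).trans hdeg)

end Sparse

/-! ### The probability that a test does not detect a difference -/

section Detection

variable {σ : Type}

/-- The point at which a test evaluates graphs. -/
def testPoint {p q : ℕ} [Fact p.Prime] [Fact q.Prime]
    (s : (σ → ZMod p) × (σ → ZMod q) × {ω : ZMod p // ω ^ q = 1}) :
    Point σ (ZMod p) (ZMod q) where
  fst := s.1
  snd := s.2.1
  char := AddChar.zmodChar q s.2.2.2

/-- The size of the boxes for the simultaneous approximation, about `q ^ (1 - 3 / (4 * k))`. -/
theorem exists_box_size {k : ℕ} (hk : 0 < k) (d : ℕ) : ∃ q₀ : ℕ, ∀ q : ℕ, q₀ ≤ q →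
    ∃ m B : ℕ, B ^ k < q ∧ q ≤ m * B ∧
      ((3 * k * d + d + 2 * m : ℕ) : ℝ) / q ≤ (q : ℝ) ^ (-(1 / (2 * k)) : ℝ) := by
  refine ⟨(3 * k * d + d + 6) ^ (4 * k), fun q hq => ?_⟩
  set u : ℝ := (q : ℝ) ^ (1 / (4 * k) : ℝ)
  have hkR : (0 : ℝ) < k := by exact_mod_cast hk
  have huq : u ^ (4 * k) = q := by
    rw [← Real.rpow_natCast, ← Real.rpow_mul (by positivity)]
    push_cast
    rw [one_div_mul_cancel (by positivity), Real.rpow_one]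
  have hu : (3 * k * d + d + 6 : ℝ) ≤ u := by
    refine le_of_pow_le_pow_left₀ (n := 4 * k) (by omega) (by positivity) ?_
    rw [huq]
    exact_mod_cast hq
  have hu6 : 6 ≤ u := by
    have : (0 : ℝ) ≤ 3 * k * d + d := by positivity
    linarith
  have hu0 : 0 < u := by linarith
  have hq0 : (0 : ℝ) < q := by
    rw [← huq]
    positivity
  have hrhs : (q : ℝ) ^ (-(1 / (2 * k)) : ℝ) = (u ^ 2)⁻¹ := by
    rw [Real.rpow_neg hq0.le, ← Real.rpow_natCast, ← Real.rpow_mul hq0.le]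
    congr 2
    push_cast
    field_simp
    norm_num
  set B := ⌊u ^ 3⌋₊
  have hB1 : (B : ℝ) ≤ u ^ 3 := Nat.floor_le (by positivity)
  have hB2 : u ^ 3 < B + 1 := Nat.lt_floor_add_one _
  have hu3 : 36 * 6 ≤ u ^ 3 := by
    calc (36 * 6 : ℝ) = 6 ^ 3 := by norm_num
      _ ≤ u ^ 3 := by gcongr
  have hB3 : u ^ 3 / 2 ≤ B := by linarith
  have hB0 : (0 : ℝ) < B := by linarith
  have hqu : u ^ 4 ≤ q := by
    rw [← huq]
    exact pow_le_pow_right₀ (by linarith) (by omega)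
  refine ⟨q / B + 1, B, ?_, ?_, ?_⟩
  · have : ((B ^ k : ℕ) : ℝ) < q := by
      push_cast
      calc (B : ℝ) ^ k ≤ (u ^ 3) ^ k := by gcongr
        _ = u ^ (3 * k) := by rw [pow_mul]
        _ < u ^ (4 * k) := pow_lt_pow_right₀ (by linarith) (by omega)
        _ = q := huq
    exact_mod_cast this
  · have h1 := Nat.div_add_mod q B
    have h2 := Nat.mod_lt q (show 0 < B by exact_mod_cast hB0)
    rw [add_mul, one_mul, mul_comm (q / B)]
    omega
  · have hdiv : ((q / B : ℕ) : ℝ) ≤ q / B := Nat.cast_div_le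
    rw [hrhs, div_le_iff₀ hq0]
    push_cast
    have h1 : (q : ℝ) / B ≤ q * (2 * (u ^ 3)⁻¹) := by
      rw [div_le_iff₀ hB0, mul_assoc]
      refine le_mul_of_one_le_right hq0.le ?_
      rw [mul_comm, ← mul_assoc, le_mul_inv_iff₀ (by positivity)]
      linarith
    have h2 : (1 : ℝ) ≤ q * (u ^ 4)⁻¹ := by
      rw [le_mul_inv_iff₀ (by positivity)]
      linarith
    have h3 : (u ^ 4)⁻¹ ≤ (u ^ 3)⁻¹ := by
      gcongr
      · linarith
      · norm_num
    have h4 : (1 : ℝ) ≤ q * (u ^ 3)⁻¹ := h2.trans (by gcongr)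
    calc (3 * k * d + d + 2 * (((q / B : ℕ) : ℝ) + 1) : ℝ)
        ≤ (3 * k * d + d) * (q * (u ^ 3)⁻¹) + 2 * (q * (2 * (u ^ 3)⁻¹) + q * (u ^ 3)⁻¹) := by
          have h5 : (3 * k * d + d : ℝ) ≤ (3 * k * d + d) * (q * (u ^ 3)⁻¹) :=
            le_mul_of_one_le_right (by positivity) h4
          linarith
      _ = (3 * k * d + d + 6) * (q * (u ^ 3)⁻¹) := by ring
      _ ≤ u * (q * (u ^ 3)⁻¹) := by gcongr
      _ = (u ^ 2)⁻¹ * q := by field_simp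

theorem uniformProb_fst_aeval_eq_zero_le {β : Type} [Finite β] [Finite σ] {p : ℕ}
    [Fact p.Prime] {f : MvPolynomial σ ℤ} {d w : ℕ} (hf : f ≠ 0) (hw : ∀ m, |f.coeff m| ≤ w)
    (hd : f.totalDegree ≤ d) (hp : w < p) :
    uniformProb Set.univ {s : (σ → ZMod p) × β | aeval s.1 f = 0} ≤ (d : ℝ) / p := by
  have h0 : MvPolynomial.map (Int.castRingHom (ZMod p)) f ≠ 0 := map_castRingHom_ne_zero hf hw hp
  have h : uniformProb Set.univ {x : σ → ZMod p | aeval x f = 0} ≤ d / (Nat.card (ZMod p) : ℝ) :=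
    uniformProb_aeval_eq_zero_le h0 hd
  rw [Nat.card_zmod] at h
  have hc : (0 : ℝ) ≤ d / p := by positivity
  exact uniformProb_univ_fst_le (E := {x : σ → ZMod p | aeval x f = 0}) hc h

theorem uniformProb_snd_aeval_eq_zero_le {α β : Type} [Finite α] [Finite β] [Finite σ] {p : ℕ}
    [Fact p.Prime] {f : MvPolynomial σ ℤ} {d w : ℕ} (hf : f ≠ 0) (hd : f.totalDegree ≤ d)
    (hw : ∀ m, |f.coeff m| ≤ w) (hp : w < p) :
    uniformProb Set.univ {s : α × (σ → ZMod p) × β | aeval s.2.1 f = 0} ≤ (d : ℝ) / p :=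
  uniformProb_univ_snd_le (E := {x : (σ → ZMod p) × β | aeval x.1 f = 0}) (by positivity)
    (uniformProb_fst_aeval_eq_zero_le hf hw hd hp)

open Classical in
/-- A formal expression that is not zero has, with high probability, a nonzero value at a random
test point. The bound does not depend on the number of variables. -/
theorem uniformProb_expSum_bad_le {k : ℕ} (hk : 0 < k) (d w : ℕ) :
    ∃ q₀ : ℕ, ∀ (p q : ℕ) [Fact p.Prime] [Fact q.Prime], q ∣ p - 1 → q₀ ≤ q →
      ∀ (σ : Type) [Finite σ] (f g h : Fin k → MvPolynomial σ ℤ),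
      (∀ i, ∀ r ∈ ({f i, g i, h i} : Set (MvPolynomial σ ℤ)),
        r.totalDegree ≤ d ∧ ∀ m, |r.coeff m| ≤ w) →
      (∀ i, h i ≠ 0) → (∃ i₀, ∑ i with g i * h i₀ = g i₀ * h i, f i ≠ 0) →
      uniformProb Set.univ {s : (σ → ZMod p) × (σ → ZMod q) × {ω : ZMod p // ω ^ q = 1} |
        ¬ ((∀ i, aeval (testPoint s).snd (h i) ≠ 0) ∧ (testPoint s).expSumEval f g h ≠ 0)} ≤
          (q : ℝ) ^ (-(1 / (2 * k)) : ℝ) := by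
  obtain ⟨q₀, hq₀⟩ := exists_box_size hk d
  refine ⟨q₀ + (k * w + w + 2 * (2 ^ (2 * d) * (w * w)) + 2), ?_⟩
  intro p q _ _ hpq hq σ _ f g h hbd hh ⟨i₀, hF⟩
  have hf : ∀ i, (f i).totalDegree ≤ d ∧ ∀ m, |(f i).coeff m| ≤ w := fun i =>
    hbd i _ (by simp)
  have hg : ∀ i, (g i).totalDegree ≤ d ∧ ∀ m, |(g i).coeff m| ≤ w := fun i =>
    hbd i _ (by simp)
  have hh' : ∀ i, (h i).totalDegree ≤ d ∧ ∀ m, |(h i).coeff m| ≤ w := fun i =>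
    hbd i _ (by simp)
  obtain ⟨m, B, hB, hm, hle⟩ := hq₀ q (by omega)
  have hq0 : 0 < q := (Fact.out : q.Prime).pos
  have hqp : q ≤ p := by
    have := Nat.le_of_dvd (by have := (Fact.out : p.Prime).two_le; omega) hpq
    omega
  have hqR : (0 : ℝ) < q := by exact_mod_cast hq0
  let F := ∑ i with g i * h i₀ = g i₀ * h i, f i
  let D : Fin k → MvPolynomial σ ℤ := fun i =>
    if g i * h i₀ = g i₀ * h i then 1 else g i * h i₀ - g i₀ * h i
  have hD : ∀ i, D i ≠ 0 ∧ (D i).totalDegree ≤ 2 * d ∧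
      ∀ m, |(D i).coeff m| ≤ ((2 * (2 ^ (2 * d) * (w * w)) + 1 : ℕ) : ℤ) := by
    intro i
    by_cases hi : g i * h i₀ = g i₀ * h i
    · simp only [D, if_pos hi]
      refine ⟨one_ne_zero, by simp, fun m => ?_⟩
      rw [coeff_one]
      split_ifs <;> simp <;> positivity
    · simp only [D, if_neg hi]
      refine ⟨sub_ne_zero.2 hi, ?_, fun m => ?_⟩
      · refine (totalDegree_sub _ _).trans (max_le ?_ ?_)
        · exact (totalDegree_mul _ _).trans (by have := (hg i).1; have := (hh' i₀).1; omega)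
        · exact (totalDegree_mul _ _).trans (by have := (hg i₀).1; have := (hh' i).1; omega)
      · rw [coeff_sub]
        have h1 := abs_coeff_mul_le (hg i).1 (hh' i₀).1 (hg i).2 (hh' i₀).2 m
        have h2 := abs_coeff_mul_le (hg i₀).1 (hh' i).1 (hg i₀).2 (hh' i).2 m
        refine (abs_sub _ _).trans ?_
        push_cast at h1 h2 ⊢
        linarith
  have hFd : F.totalDegree ≤ d := totalDegree_finsetSum_le fun i _ => (hf i).1
  have hFw : ∀ m, |F.coeff m| ≤ ((k * w : ℕ) : ℤ) := by
    intro m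
    simp only [F, coeff_sum]
    refine (Finset.abs_sum_le_sum_abs _ _).trans ((Finset.sum_le_sum_of_subset_of_nonneg
      (Finset.filter_subset _ _) fun _ _ _ => abs_nonneg _).trans
      ((Finset.sum_le_sum fun i _ => (hf i).2 m).trans ?_))
    simp
  -- The test can only fail to detect the expression on one of the following four events.
  let E₁ : Fin k → Set ((σ → ZMod p) × (σ → ZMod q) × {ω : ZMod p // ω ^ q = 1}) := fun i =>
    {s | aeval s.2.1 (h i) = 0}
  let E₂ : Fin k → Set ((σ → ZMod p) × (σ → ZMod q) × {ω : ZMod p // ω ^ q = 1}) := fun i =>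
    {s | aeval s.2.1 (D i) = 0}
  let E₃ : Set ((σ → ZMod p) × (σ → ZMod q) × {ω : ZMod p // ω ^ q = 1}) :=
    {s | aeval s.1 F = 0}
  let E₄ : Set ((σ → ZMod p) × (σ → ZMod q) × {ω : ZMod p // ω ^ q = 1}) :=
    {s | (∀ i, aeval s.2.1 (h i) ≠ 0) ∧ (∀ i, aeval s.2.1 (D i) ≠ 0) ∧ aeval s.1 F ≠ 0 ∧
      (testPoint s).expSumEval f g h = 0}
  have hsub : {s : (σ → ZMod p) × (σ → ZMod q) × {ω : ZMod p // ω ^ q = 1} |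
      ¬ ((∀ i, aeval (testPoint s).snd (h i) ≠ 0) ∧ (testPoint s).expSumEval f g h ≠ 0)} ⊆
      (⋃ i, E₁ i) ∪ ((⋃ i, E₂ i) ∪ (E₃ ∪ E₄)) := by
    intro s hs
    by_contra hn
    simp only [Set.mem_union, Set.mem_iUnion, not_or, not_exists] at hn
    obtain ⟨h1, h2, h3, h4⟩ := hn
    exact hs ⟨h1, fun h5 => h4 ⟨h1, h2, h3, h5⟩⟩
  have hE₁ : uniformProb Set.univ (⋃ i, E₁ i) ≤ k * ((d : ℝ) / q) :=
    uniformProb_univ_iUnion_le _ fun i =>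
      uniformProb_snd_aeval_eq_zero_le (hh i) (hh' i).1 (hh' i).2 (by omega)
  have hE₂ : uniformProb Set.univ (⋃ i, E₂ i) ≤ k * (((2 * d : ℕ) : ℝ) / q) :=
    uniformProb_univ_iUnion_le _ fun i =>
      uniformProb_snd_aeval_eq_zero_le (hD i).1 (hD i).2.1 (hD i).2.2 (by omega)
  have hE₃ : uniformProb Set.univ E₃ ≤ (d : ℝ) / q := by
    have := uniformProb_fst_aeval_eq_zero_le (β := (σ → ZMod q) × {ω : ZMod p // ω ^ q = 1})
      hF hFw hFd (p := p) (by omega)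
    exact this.trans (by gcongr)
  have hE₄ : uniformProb Set.univ E₄ ≤ (2 * m : ℕ) / (q : ℝ) := by
    refine uniformProb_univ_prod_le (by positivity) fun x =>
      uniformProb_univ_prod_le (by positivity) fun y => ?_
    by_cases hxy : (∀ i, aeval y (h i) ≠ 0) ∧ (∀ i, aeval y (D i) ≠ 0) ∧ aeval x F ≠ 0
    · obtain ⟨h1, h2, h3⟩ := hxy
      have hc : ∑ i with aeval y (g i) / aeval y (h i) = aeval y (g i₀) / aeval y (h i₀),
          aeval x (f i) ≠ 0 := by
        rw [map_sum] at h3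
        convert h3 using 2
        refine Finset.filter_congr fun i _ => ?_
        rw [div_eq_div_iff (h1 _) (h1 _), ← map_mul, ← map_mul]
        refine ⟨fun h => by_contra fun hne => h2 i ?_, fun h => by rw [h]⟩
        simp only [D, if_neg hne]
        rw [map_sub, h, sub_self]
      rw [uniformProb_univ, card_rootsOfUnity hpq]
      gcongr
      exact (Set.ncard_le_ncard fun ω hω => hω.2.2.2).trans
        (card_sparse_zeros_le (fun i => aeval x (f i))
          (fun i => aeval y (g i) / aeval y (h i)) i₀ hc hB hm)
    · have : {ω | (y, ω) ∈ {z : (σ → ZMod q) × {ω : ZMod p // ω ^ q = 1} | (x, z) ∈ E₄}} = ∅ :=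
        Set.eq_empty_of_forall_notMem fun ω hω => hxy ⟨hω.1, hω.2.1, hω.2.2.1⟩
      rw [this]
      simp only [uniformProb, Set.inter_empty, Set.ncard_empty, Nat.cast_zero, zero_div]
      positivity
  refine (uniformProb_univ_mono hsub).trans ?_
  have h1 := uniformProb_univ_union_le (⋃ i, E₁ i) ((⋃ i, E₂ i) ∪ (E₃ ∪ E₄))
  have h2 := uniformProb_univ_union_le (⋃ i, E₂ i) (E₃ ∪ E₄)
  have h3 := uniformProb_univ_union_le E₃ E₄
  have h4 : ((3 * k * d + d + 2 * m : ℕ) : ℝ) / q =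
      k * ((d : ℝ) / q) + k * (((2 * d : ℕ) : ℝ) / q) + (d : ℝ) / q + (2 * m : ℕ) / (q : ℝ) := by
    push_cast
    ring
  linarith

end Detection

/-! ### The family of all tests -/

/-- A test, together with the primes that it uses. -/
structure TestPoint (σ : Type) where
  p : ℕ
  q : ℕ
  prime_p : Fact p.Prime
  prime_q : Fact q.Prime
  sample : (σ → ZMod p) × (σ → ZMod q) × {ω : ZMod p // ω ^ q = 1}

section TestFilter

variable {σ : Type}

instance (t : TestPoint σ) : Fact t.p.Prime := t.prime_p

instance (t : TestPoint σ) : Fact t.q.Prime := t.prime_q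

/-- The filter of the sets that contain, if `q` is large, almost all tests. -/
def testFilter (σ : Type) [Finite σ] : Filter (TestPoint σ) where
  sets := {S | ∀ ε : ℝ, 0 < ε → ∃ q₁ : ℕ, ∀ (p q : ℕ) [hp : Fact p.Prime] [hq : Fact q.Prime],
    q ∣ p - 1 → q₁ ≤ q → uniformProb Set.univ {s | (⟨p, q, hp, hq, s⟩ : TestPoint σ) ∉ S} ≤ ε}
  univ_sets := fun ε hε => ⟨0, fun p q _ _ _ _ => by
    simpa [uniformProb_univ] using hε.le⟩
  sets_of_superset := fun h hST ε hε => by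
    obtain ⟨q₁, h⟩ := h ε hε
    exact ⟨q₁, fun p q _ _ hpq hq =>
      (uniformProb_univ_mono fun _ hs => mt (@hST _) hs).trans (h p q hpq hq)⟩
  inter_sets := fun h h' ε hε => by
    obtain ⟨q₁, h⟩ := h (ε / 2) (half_pos hε)
    obtain ⟨q₁', h'⟩ := h' (ε / 2) (half_pos hε)
    refine ⟨q₁ + q₁', fun p q _ _ hpq hq => ?_⟩
    refine (uniformProb_univ_mono (E' := _ ∪ _) fun s hs => ?_).trans
      ((uniformProb_univ_union_le _ _).trans
        ((add_le_add (h p q hpq (by omega)) (h' p q hpq (by omega))).trans (add_halves ε).le))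
    by_contra hn
    simp only [Set.mem_union, not_or, Set.mem_ofPred_eq, not_not] at hn
    exact hs hn

theorem exists_polynomial_bounds {k : ℕ} (f g h : Fin k → MvPolynomial σ ℤ) :
    ∃ d w : ℕ, ∀ i, ∀ r ∈ ({f i, g i, h i} : Set (MvPolynomial σ ℤ)),
      r.totalDegree ≤ d ∧ ∀ m, |r.coeff m| ≤ w := by
  have key : ∀ r : MvPolynomial σ ℤ, ∃ b : ℕ, r.totalDegree ≤ b ∧ ∀ m, |r.coeff m| ≤ b := by
    intro r
    refine ⟨r.totalDegree + ∑ m ∈ r.support, (r.coeff m).natAbs, by omega, fun m => ?_⟩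
    by_cases hm : m ∈ r.support
    · have := Finset.single_le_sum (f := fun m => (r.coeff m).natAbs) (fun _ _ => Nat.zero_le _) hm
      rw [Int.abs_eq_natAbs]
      exact_mod_cast this.trans (Nat.le_add_left _ _)
    · rw [notMem_support_iff.1 hm, abs_zero]
      positivity
  choose b hb using key
  have hle : ∀ i, b (f i) + b (g i) + b (h i) ≤ ∑ i, (b (f i) + b (g i) + b (h i)) := fun i =>
    Finset.single_le_sum (f := fun i => b (f i) + b (g i) + b (h i)) (fun _ _ => Nat.zero_le _)
      (Finset.mem_univ i)
  refine ⟨∑ i, (b (f i) + b (g i) + b (h i)), ∑ i, (b (f i) + b (g i) + b (h i)),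
    fun i r hr => ?_⟩
  have hr' : b r ≤ ∑ i, (b (f i) + b (g i) + b (h i)) := by
    have := hle i
    rcases hr with rfl | rfl | rfl <;> omega
  exact ⟨(hb r).1.trans hr', fun m => ((hb r).2 m).trans (by exact_mod_cast hr')⟩

theorem genericPoints_test [Finite σ] (K : Type) [Field K] [Algebra (MvPolynomial σ ℤ) K]
    [IsFractionRing (MvPolynomial σ ℤ) K] :
    GenericPoints K (testFilter σ) fun t => testPoint t.sample := by
  classical
  intro k f g h hh h0
  obtain ⟨i₀, hF⟩ := exists_of_expSum_ne_zero K hh h0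
  obtain ⟨d, w, hbd⟩ := exists_polynomial_bounds f g h
  have hk : 0 < k := i₀.pos
  intro ε hε
  obtain ⟨q₀, hq₀⟩ := uniformProb_expSum_bad_le hk d w
  have hlim : Tendsto (fun q : ℕ => (q : ℝ) ^ (-(1 / (2 * k)) : ℝ)) atTop (nhds 0) :=
    (tendsto_rpow_neg_atTop (by positivity)).comp tendsto_natCast_atTop_atTop
  obtain ⟨q₁, hq₁⟩ := (hlim.eventually (ge_mem_nhds hε)).exists_forall_of_atTop
  refine ⟨q₀ + q₁, fun p q _ _ hpq hq => ?_⟩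
  exact (hq₀ p q hpq (by omega) σ f g h hbd hh ⟨i₀, by convert hF⟩).trans (hq₁ q (by omega))

end TestFilter

/-! ### Equivalent graphs have the same formal values -/

/-- Fields of rational functions and of fractions of formal expressions exist. -/
theorem exists_formal_fields (σ : Type) :
    ∃ (K : Type) (_ : Field K) (_ : Algebra (MvPolynomial σ ℤ) K)
      (_ : IsFractionRing (MvPolynomial σ ℤ) K) (L : Type) (_ : Field L)
      (_ : Algebra (AddMonoidAlgebra (MvPolynomial σ ℤ) K) L),
      IsFractionRing (AddMonoidAlgebra (MvPolynomial σ ℤ) K) L := by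
  let K := FractionRing (MvPolynomial σ ℤ)
  have : CharZero K :=
    charZero_of_injective_algebraMap (IsFractionRing.injective (MvPolynomial σ ℤ) K)
  have : IsDomain (AddMonoidAlgebra (MvPolynomial σ ℤ) K) := inferInstance
  exact ⟨K, inferInstance, inferInstance, inferInstance,
    FractionRing (AddMonoidAlgebra (MvPolynomial σ ℤ) K), inferInstance, inferInstance,
    inferInstance⟩

section FormalValues

variable {Γ Δ : List Shape} {K L : Type} [Field K]
  [Algebra (MvPolynomial (Entry Γ) ℤ) K] [IsFractionRing (MvPolynomial (Entry Γ) ℤ) K] [Field L]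
  [Algebra (AddMonoidAlgebra (MvPolynomial (Entry Γ) ℤ) K) L]
  [IsFractionRing (AddMonoidAlgebra (MvPolynomial (Entry Γ) ℤ) K) L]
  {G₁ G₂ : MuGraph Γ Δ} {e : Entry Δ} {r₁ r₂ : L}

theorem EquivalentAt.formal_eq (h : EquivalentAt G₁ G₂ e) (h₁ : G₁.formalRun K L e = some r₁)
    (h₂ : G₂.formalRun K L e = some r₂) : r₁ = r₂ := by
  have hgen := genericPoints_rational (σ := Entry Γ) K
  rw [← sub_eq_zero]
  refine hgen.valPlace.eq_zero ?_
  filter_upwards [hgen.eventually_pointRun G₁ e h₁, hgen.eventually_pointRun G₂ e h₂]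
    with x ⟨a, ha, ha'⟩ ⟨b, hb, hb'⟩
  have hab := h _ a b (G₁.realRun_eq_some_of_pointRun _ x e ha')
    (G₂.realRun_eq_some_of_pointRun _ x e hb')
  have := ha.sub hb
  rwa [hab, sub_self] at this

theorem EquivalentAt.testRun_eq (h : EquivalentAt G₁ G₂ e) {p q : ℕ} [Fact p.Prime]
    [Fact q.Prime] (s : Sample p q Γ) {a b : ZMod p} (ha : G₁.testRun s e = some a)
    (hb : G₂.testRun s e = some b) : a = b := by
  obtain ⟨K, _, _, _, L, _, _, _⟩ := exists_formal_fields (Entry Γ)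
  obtain ⟨r₁, hr₁, hs₁⟩ := (testPoint s).exists_spec (K := K) (L := L) G₁ e ha
  obtain ⟨r₂, hr₂, hs₂⟩ := (testPoint s).exists_spec (K := K) (L := L) G₂ e hb
  rw [h.formal_eq hr₁ hr₂] at hs₁
  exact hs₁.unique hs₂

/-! ### The normal form -/

theorem map_aeval_int {σ R S : Type} [CommRing R] [CommRing S] (c : R →+* S) (x : σ → R)
    (r : MvPolynomial σ ℤ) : c (aeval x r) = aeval (fun j => c (x j)) r := by
  rw [aeval_def, aeval_def, hom_eval₂, RingHom.ext_int (c.comp _) (algebraMap ℤ S)]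

theorem expSumEval_realPoint {σ F : Type} [Field F] (c : F →+* ℝ) (x : σ → F) {k : ℕ}
    (f g h : Fin k → MvPolynomial σ ℤ) :
    (realPoint c x).expSumEval f g h = ∑ i, aeval (fun j => c (x j)) (f i) *
      Real.exp (aeval (fun j => c (x j)) (g i) / aeval (fun j => c (x j)) (h i)) := by
  refine Finset.sum_congr rfl fun i _ => ?_
  rw [← map_aeval_int c x (g i), ← map_aeval_int c x (h i), ← map_div₀ c]
  rfl

variable (K L) in
/-- The formal value of a normal form. -/
def LaxForm.formal {k k' : ℕ} (P : LaxForm (Entry Γ) k k') : L :=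
  algebraMap _ L (expSum K P.f P.g P.h) / algebraMap _ L (expSum K P.f' P.g' P.h')

theorem LaxForm.DefinedAt.formal_spec {k k' : ℕ} {P : LaxForm (Entry Γ) k k'} {F : Type}
    [Field F] {c : F →+* ℝ} {x : Entry Γ → F} (h : P.DefinedAt fun i => c (x i)) :
    ((realPoint c x).valPlace K L).Spec (P.formal K L)
      (P.num (fun i => c (x i)) / P.den (fun i => c (x i))) := by
  have hx : ∀ r : MvPolynomial (Entry Γ) ℤ, aeval (fun i => c (x i)) r ≠ 0 → aeval x r ≠ 0 := by
    intro r hr h0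
    apply hr
    rw [← map_aeval_int, h0, map_zero]
  have h1 := (realPoint c x).valPlace_expSum (K := K) (L := L) P.f P.g P.h fun i => hx _ (h.1 i)
  have h2 := (realPoint c x).valPlace_expSum (K := K) (L := L) P.f' P.g' P.h'
    fun i => hx _ (h.2.1 i)
  rw [expSumEval_realPoint] at h1 h2
  exact h1.div h2 h.2.2

theorem Graph.IsLax.exists_spec {G : MuGraph Γ Δ} (hG : G.IsLax) {x : Entry Γ → ℝ} {a : ℝ}
    (h : G.realRun x e = some a) : ∃ r, G.formalRun K L e = some r ∧
      ((realPoint (RingHom.id ℝ) x).valPlace K L).Spec r a :=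
  (realPoint (RingHom.id ℝ) x).exists_spec G e (hG.pointRun_eq_some x e h)

theorem exists_isDifference (hG₁ : G₁.IsLax) (hG₂ : G₂.IsLax) (e : Entry Δ) :
    ∃ (k k' d w : ℕ) (P : LaxForm (Entry Γ) k k'), IsDifference G₁ G₂ e P ∧ P.Bounded d w := by
  obtain ⟨K, _, _, _, L, _, _, _⟩ := exists_formal_fields (Entry Γ)
  -- A difference that is nowhere defined is represented by any formal value.
  obtain ⟨r, hr⟩ : ∃ r : L, ∀ r₁ r₂, G₁.formalRun K L e = some r₁ →
      G₂.formalRun K L e = some r₂ → r₁ - r₂ = r := by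
    by_cases h : ∃ r₁ r₂, G₁.formalRun K L e = some r₁ ∧ G₂.formalRun K L e = some r₂
    · obtain ⟨r₁, r₂, h₁, h₂⟩ := h
      refine ⟨r₁ - r₂, fun r₁' r₂' h₁' h₂' => ?_⟩
      rw [h₁, Option.some.injEq] at h₁'
      rw [h₂, Option.some.injEq] at h₂'
      rw [h₁', h₂']
    · exact ⟨0, fun r₁ r₂ h₁ h₂ => absurd ⟨r₁, r₂, h₁, h₂⟩ h⟩
  obtain ⟨N, D, hD, hND⟩ := IsFractionRing.div_surjective
    (A := AddMonoidAlgebra (MvPolynomial (Entry Γ) ℤ) K) r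
  have hD0 : D ≠ 0 := nonZeroDivisors.ne_zero hD
  obtain ⟨k, f, g, h, hh, rfl⟩ := exists_expSum_eq K N
  obtain ⟨k', f', g', h', hh', rfl⟩ := exists_expSum_eq K D
  obtain ⟨d, w, hb⟩ := exists_polynomial_bounds f g h
  obtain ⟨d', w', hb'⟩ := exists_polynomial_bounds f' g' h'
  let P : LaxForm (Entry Γ) k k' := ⟨f, g, h, f', g', h'⟩
  have hgen := genericPoints_rational (σ := Entry Γ) K
  refine ⟨k, k', d + d', w + w', P, ⟨?_, fun x a b hx ha hb => ?_⟩, ?_, ?_⟩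
  · have hx : ∀ (x : Entry Γ → ℚ) (r : MvPolynomial (Entry Γ) ℤ), aeval x r ≠ 0 →
        aeval (fun i => (Rat.castHom ℝ) (x i)) r ≠ 0 := by
      intro x r hr
      rw [← map_aeval_int]
      exact (map_ne_zero _).2 hr
    obtain ⟨x, h1, h2, h3⟩ := ((eventually_all.2 fun i => hgen.snd_ne_zero (hh i)).and
      (hgen k' f' g' h' hh' hD0)).exists
    rw [expSumEval_realPoint] at h3
    exact ⟨fun i => Rat.castHom ℝ (x i), fun i => hx _ _ (h1 i), fun i => hx _ _ (h2 i), h3⟩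
  · obtain ⟨r₁, hr₁, hs₁⟩ := hG₁.exists_spec (K := K) (L := L) ha
    obtain ⟨r₂, hr₂, hs₂⟩ := hG₂.exists_spec (K := K) (L := L) hb
    have hs := hs₁.sub hs₂
    rw [hr r₁ r₂ hr₁ hr₂, ← hND] at hs
    exact hs.unique (LaxForm.DefinedAt.formal_spec (c := RingHom.id ℝ) hx)
  · exact fun i r hr => ⟨((hb i r hr).1).trans (Nat.le_add_right _ _), fun m =>
      ((hb i r hr).2 m).trans (by push_cast; linarith [Int.natCast_nonneg w'])⟩
  · exact fun i r hr => ⟨((hb' i r hr).1).trans (Nat.le_add_left _ _), fun m =>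
      ((hb' i r hr).2 m).trans (by push_cast; linarith [Int.natCast_nonneg w])⟩

/-- A normal form of the difference of two graphs is also the formal difference. -/
theorem IsDifference.formal_eq {k k' : ℕ} {P : LaxForm (Entry Γ) k k'}
    (hP : IsDifference G₁ G₂ e P) (h₁ : G₁.formalRun K L e = some r₁)
    (h₂ : G₂.formalRun K L e = some r₂) :
    (∀ i, P.h i ≠ 0) ∧ (r₁ - r₂) * algebraMap _ L (expSum K P.f' P.g' P.h') =
      algebraMap _ L (expSum K P.f P.g P.h) := by
  obtain ⟨⟨x₀, hx₀⟩, hdiff⟩ := hP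
  have hh : ∀ i, P.h i ≠ 0 := fun i h => hx₀.1 i (by rw [h, map_zero])
  have hh' : ∀ i, P.h' i ≠ 0 := fun i h => hx₀.2.1 i (by rw [h, map_zero])
  have hden : expSum K P.f' P.g' P.h' ≠ 0 := by
    intro h0
    have h1 := (realPoint (RingHom.id ℝ) x₀).valPlace_expSum (K := K) (L := L) P.f' P.g' P.h'
      hx₀.2.1
    rw [h0, map_zero, expSumEval_realPoint] at h1
    exact hx₀.2.2 (h1.unique Place.spec_zero)
  refine ⟨hh, ?_⟩
  have hdenL : algebraMap _ L (expSum K P.f' P.g' P.h') ≠ 0 :=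
    (map_ne_zero_iff _ (IsFractionRing.injective _ L)).2 hden
  have hgen := genericPoints_rational (σ := Entry Γ) K
  rw [← eq_div_iff hdenL, ← sub_eq_zero]
  refine hgen.valPlace.eq_zero ?_
  filter_upwards [hgen.eventually_pointRun G₁ e h₁, hgen.eventually_pointRun G₂ e h₂,
    eventually_all.2 fun i => hgen.snd_ne_zero (hh i),
    hgen _ P.f' P.g' P.h' hh' hden] with x ⟨a, ha, ha'⟩ ⟨b, hb, hb'⟩ h3 ⟨h4, h5⟩
  rw [expSumEval_realPoint] at h5
  have hx : P.DefinedAt fun i => Rat.castHom ℝ (x i) := by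
    refine ⟨fun i => ?_, fun i => ?_, h5⟩
    · rw [← map_aeval_int]
      exact (map_ne_zero _).2 (h3 i)
    · rw [← map_aeval_int]
      exact (map_ne_zero _).2 (h4 i)
  have hs := (ha.sub hb).sub (hx.formal_spec (K := K) (L := L))
  rwa [hdiff _ a b hx (G₁.realRun_eq_some_of_pointRun _ x e ha')
    (G₂.realRun_eq_some_of_pointRun _ x e hb'), sub_self] at hs

/-! ### Non-equivalent graphs are detected -/

/-- For Lax graphs that are not equivalent at an output entry, the formal difference exists and is
not zero, and therefore the numerator of any normal form is not zero as a formal expression. -/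
theorem exists_formal_ne_zero (hG₁ : G₁.IsLax) (hG₂ : G₂.IsLax) (hne : ¬ EquivalentAt G₁ G₂ e)
    {k k' : ℕ} {P : LaxForm (Entry Γ) k k'} (hP : IsDifference G₁ G₂ e P) (K L : Type) [Field K]
    [Algebra (MvPolynomial (Entry Γ) ℤ) K] [IsFractionRing (MvPolynomial (Entry Γ) ℤ) K] [Field L]
    [Algebra (AddMonoidAlgebra (MvPolynomial (Entry Γ) ℤ) K) L]
    [IsFractionRing (AddMonoidAlgebra (MvPolynomial (Entry Γ) ℤ) K) L] :
    ∃ r : L, (∀ r₁ r₂, G₁.formalRun K L e = some r₁ → G₂.formalRun K L e = some r₂ →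
      r₁ - r₂ = r) ∧ (∀ i, P.h i ≠ 0) ∧ expSum K P.f P.g P.h ≠ 0 ∧
      r * algebraMap _ L (expSum K P.f' P.g' P.h') = algebraMap _ L (expSum K P.f P.g P.h) := by
  simp only [EquivalentAt, not_forall] at hne
  obtain ⟨x, a, b, ha, hb, hab⟩ := hne
  obtain ⟨r₁, hr₁, hs₁⟩ := hG₁.exists_spec (K := K) (L := L) ha
  obtain ⟨r₂, hr₂, hs₂⟩ := hG₂.exists_spec (K := K) (L := L) hb
  obtain ⟨hh, h⟩ := hP.formal_eq hr₁ hr₂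
  refine ⟨r₁ - r₂, fun r₁' r₂' h₁' h₂' => ?_, hh, fun h0 => ?_, h⟩
  · rw [hr₁, Option.some.injEq] at h₁'
    rw [hr₂, Option.some.injEq] at h₂'
    rw [h₁', h₂']
  · have hr : r₁ - r₂ ≠ 0 := (hs₁.sub hs₂).ne_zero (sub_ne_zero.2 hab)
    obtain ⟨⟨x₀, hx₀⟩, -⟩ := hP
    have h1 := (realPoint (RingHom.id ℝ) x₀).valPlace_expSum (K := K) (L := L) P.f' P.g' P.h'
      hx₀.2.1
    rw [h0, map_zero, mul_eq_zero, or_iff_right hr] at h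
    rw [h, expSumEval_realPoint] at h1
    exact hx₀.2.2 (h1.unique Place.spec_zero)

/-- Almost all admissible tests detect that two Lax graphs are not equivalent. -/
theorem uniformProb_pass_le {k : ℕ} (hk : 0 < k) (d w : ℕ) :
    ∃ q₀ : ℕ, ∀ (Γ Δ : List Shape) (G₁ G₂ : MuGraph Γ Δ), G₁.IsLax → G₂.IsLax →
      ∀ e : Entry Δ, ¬ EquivalentAt G₁ G₂ e →
      ∀ (k' : ℕ) (P : LaxForm (Entry Γ) k k'), IsDifference G₁ G₂ e P → P.Bounded d w →
      ∀ (p q : ℕ) [Fact p.Prime] [Fact q.Prime], q ∣ p - 1 → q₀ ≤ q →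
        uniformProb Set.univ {s : Sample p q Γ | Admissible G₁ G₂ s ∧ PassesTest G₁ G₂ s} ≤
          (q : ℝ) ^ (-(1 / (2 * k)) : ℝ) := by
  classical
  obtain ⟨q₀, hq₀⟩ := uniformProb_expSum_bad_le hk d w
  refine ⟨q₀, fun Γ Δ G₁ G₂ hG₁ hG₂ e hne k' P hP hPb p q _ _ hpq hq => ?_⟩
  obtain ⟨K, _, _, _, L, _, _, _⟩ := exists_formal_fields (Entry Γ)
  obtain ⟨r, hr, hh, hN, hrN⟩ := exists_formal_ne_zero hG₁ hG₂ hne hP K L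
  obtain ⟨i₀, hF⟩ := exists_of_expSum_ne_zero K hh hN
  refine (uniformProb_univ_mono fun s hs => ?_).trans
    (hq₀ p q hpq hq (Entry Γ) P.f P.g P.h hPb.1 hh ⟨i₀, by convert hF⟩)
  obtain ⟨hadm, hpass⟩ := hs
  rintro ⟨hdef, hval⟩
  obtain ⟨a, ha⟩ := Option.isSome_iff_exists.1 (hadm e).1
  obtain ⟨b, hb⟩ := Option.isSome_iff_exists.1 (hadm e).2
  obtain ⟨r₁, hr₁, hs₁⟩ := (testPoint s).exists_spec (K := K) (L := L) G₁ e ha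
  obtain ⟨r₂, hr₂, hs₂⟩ := (testPoint s).exists_spec (K := K) (L := L) G₂ e hb
  have hs := hs₁.sub hs₂
  rw [hpass e a b ha hb, sub_self, hr r₁ r₂ hr₁ hr₂] at hs
  obtain ⟨n, hn, hnval⟩ := (testPoint s).exists_incl_eq_expSum (K := K) P.f P.g P.h hdef
  rw [← hn] at hrN
  exact hval (hnval ▸ (testPoint s).evalHom_eq_zero hs hrN)

/-- If two Lax graphs have all their outputs defined somewhere, then almost all tests are
admissible. -/
theorem eventually_admissible (hG₁ : G₁.IsLax) (hG₂ : G₂.IsLax)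
    (h₁ : ∃ x, ∀ o, (G₁.realRun x o).isSome) (h₂ : ∃ x, ∀ o, (G₂.realRun x o).isSome) :
    ∀ᶠ t in testFilter (Entry Γ), Admissible (p := t.p) (q := t.q) G₁ G₂ t.sample := by
  obtain ⟨K, _, _, _, L, _, _, _⟩ := exists_formal_fields (Entry Γ)
  have hgen := genericPoints_test (σ := Entry Γ) K
  have key : ∀ G : MuGraph Γ Δ, G.IsLax → (∃ x, ∀ o, (G.realRun x o).isSome) → ∀ o,
      ∀ᶠ t in testFilter (Entry Γ), (G.testRun (p := t.p) (q := t.q) t.sample o).isSome := by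
    rintro G hG ⟨x, hx⟩ o
    obtain ⟨a, ha⟩ := Option.isSome_iff_exists.1 (hx o)
    obtain ⟨r, hr, -⟩ := hG.exists_spec (K := K) (L := L) ha
    filter_upwards [hgen.eventually_pointRun G o hr] with t ⟨b, _, hb⟩
    exact Option.isSome_iff_exists.2 ⟨b, hb⟩
  exact eventually_all.2 fun o => (key G₁ hG₁ h₁ o).and (key G₂ hG₂ h₂ o)

end FormalValues

/-- The number of tests that makes the error probability at most `δ`. -/
theorem pow_le_of_number_of_tests {k q T : ℕ} (hk : 0 < k) (hq : 1 < q) {δ ρ : ℝ} (hδ : 0 < δ)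
    (hδ1 : δ ≤ 1) (hρ0 : 0 ≤ ρ) (hρ : ρ ≤ (q : ℝ) ^ (-(1 / (4 * k)) : ℝ))
    (hT : 4 * ((k : ℝ) ^ 2 / Real.log q) * Real.log (1 / δ) ≤ T) : ρ ^ T ≤ δ := by
  have hk1 : (1 : ℝ) ≤ k := by exact_mod_cast hk
  have hlog : 0 < Real.log q := Real.log_pos (by exact_mod_cast hq)
  have hq0 : (0 : ℝ) < q := by positivity
  have hlogδ : 0 ≤ Real.log (1 / δ) := Real.log_nonneg (by rwa [le_div_iff₀ hδ, one_mul])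
  have h1 : Real.log (1 / δ) ≤ Real.log q * (1 / (4 * k)) * T := by
    calc Real.log (1 / δ) ≤ k * Real.log (1 / δ) := le_mul_of_one_le_left hlogδ hk1
      _ = Real.log q * (1 / (4 * k)) * (4 * ((k : ℝ) ^ 2 / Real.log q) * Real.log (1 / δ)) := by
          field_simp
      _ ≤ _ := by gcongr
  calc ρ ^ T ≤ ((q : ℝ) ^ (-(1 / (4 * k)) : ℝ)) ^ T := by gcongr
    _ = Real.exp (-(Real.log q * (1 / (4 * k)) * T)) := by
        rw [Real.rpow_def_of_pos hq0, ← Real.exp_nat_mul]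
        congr 1
        ring
    _ ≤ Real.exp (-Real.log (1 / δ)) := Real.exp_le_exp.2 (neg_le_neg h1)
    _ = δ := by rw [one_div, Real.log_inv, neg_neg, Real.exp_log hδ]

/-- For large `q`, half of the exponent of the error bound absorbs the factor two that comes from
conditioning on admissible tests. -/
theorem rpow_neg_half_le {k q : ℕ} (hk : 0 < k) (hq : 2 ^ (4 * k) ≤ q) :
    2 * (q : ℝ) ^ (-(1 / (2 * k)) : ℝ) ≤ (q : ℝ) ^ (-(1 / (4 * k)) : ℝ) := by
  have hkR : (0 : ℝ) < k := by exact_mod_cast hk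
  have hqR : (2 : ℝ) ^ (4 * k) ≤ q := by exact_mod_cast hq
  have hq0 : (0 : ℝ) < q := lt_of_lt_of_le (by positivity) hqR
  have h1 : (q : ℝ) ^ (-(1 / (2 * k)) : ℝ) =
      (q : ℝ) ^ (-(1 / (4 * k)) : ℝ) * (q : ℝ) ^ (-(1 / (4 * k)) : ℝ) := by
    rw [← Real.rpow_add hq0]
    congr 1
    field_simp
    norm_num
  have h2 : (2 : ℝ) ≤ (q : ℝ) ^ (1 / (4 * k) : ℝ) := by
    calc (2 : ℝ) = ((2 : ℝ) ^ (4 * k)) ^ (1 / (4 * k) : ℝ) := by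
          rw [← Real.rpow_natCast, ← Real.rpow_mul (by norm_num)]
          push_cast
          rw [mul_one_div_cancel (by positivity), Real.rpow_one]
      _ ≤ _ := by gcongr
  have h3 : 2 * (q : ℝ) ^ (-(1 / (4 * k)) : ℝ) ≤ 1 := by
    rw [Real.rpow_neg hq0.le, mul_inv_le_iff₀ (by positivity), one_mul]
    exact h2
  rw [h1, ← mul_assoc]
  exact mul_le_of_le_one_left (by positivity) h3

end MuGraph

end

open MuGraph in
theorem theorem3 :
    -- Equivalent μGraphs pass all tests.
    (∀ (Γ Δ : List Shape) (G₁ G₂ : MuGraph Γ Δ), Equivalent G₁ G₂ →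
      ∀ (p q : ℕ) [Fact p.Prime] [Fact q.Prime], q ∣ p - 1 →
        ∀ (T : ℕ) (s : Fin T → Sample p q Γ), PassesVerification G₁ G₂ s) ∧
    -- The difference of two Lax μGraphs has the normal form, at every output entry.
    (∀ (Γ Δ : List Shape) (G₁ G₂ : MuGraph Γ Δ), G₁.IsLax → G₂.IsLax → ∀ e : Entry Δ,
      ∃ (k k' d w : ℕ) (P : LaxForm (Entry Γ) k k'), IsDifference G₁ G₂ e P ∧ P.Bounded d w) ∧
    -- Non-equivalent Lax μGraphs are detected by `C * (k² / ln q) * ln (1 / δ)` tests.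
    (∃ C : ℝ, 0 < C ∧ ∀ k d w : ℕ, ∃ q₀ : ℕ,
      ∀ (Γ Δ : List Shape) (G₁ G₂ : MuGraph Γ Δ), G₁.IsLax → G₂.IsLax →
      ∀ e : Entry Δ, ¬ EquivalentAt G₁ G₂ e →
      ∀ (k' : ℕ) (P : LaxForm (Entry Γ) k k'), IsDifference G₁ G₂ e P → P.Bounded d w →
        -- Uniform samples.
        (∀ (p q : ℕ) [Fact p.Prime] [Fact q.Prime], q ∣ p - 1 → q₀ ≤ q →
          ∀ δ : ℝ, 0 < δ → δ ≤ 1 →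
          ∀ T : ℕ, C * ((k : ℝ) ^ 2 / Real.log q) * Real.log (1 / δ) ≤ T →
            uniformProb (Set.univ : Set (Fin T → Sample p q Γ))
              {s | (∀ t, Admissible G₁ G₂ (s t)) ∧ PassesVerification G₁ G₂ s} ≤ δ) ∧
        -- Samples that lead to a division by zero are redrawn.
        ((∃ x, ∀ o, (G₁.realRun x o).isSome) → (∃ x, ∀ o, (G₂.realRun x o).isSome) →
          ∃ q₁ : ℕ, ∀ (p q : ℕ) [Fact p.Prime] [Fact q.Prime], q ∣ p - 1 → q₁ ≤ q →
            (∃ s : Sample p q Γ, Admissible G₁ G₂ s) ∧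
            ∀ δ : ℝ, 0 < δ → δ ≤ 1 →
            ∀ T : ℕ, C * ((k : ℝ) ^ 2 / Real.log q) * Real.log (1 / δ) ≤ T →
              uniformProb {s : Fin T → Sample p q Γ | ∀ t, Admissible G₁ G₂ (s t)}
                {s | PassesVerification G₁ G₂ s} ≤ δ)) := by
  refine ⟨?_, fun Γ Δ G₁ G₂ h₁ h₂ e => exists_isDifference h₁ h₂ e, 4, by norm_num, ?_⟩
  · intro Γ Δ G₁ G₂ h p q _ _ _ T s t e a b ha hb
    exact (h e).testRun_eq (s t) ha hb
  intro k d w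
  rcases Nat.eq_zero_or_pos k with rfl | hk
  -- A numerator without terms is zero, so that the graphs are equivalent.
  · refine ⟨0, fun Γ Δ G₁ G₂ hG₁ hG₂ e hne k' P hP _ => ?_⟩
    obtain ⟨K, _, _, _, L, _, _, _⟩ := exists_formal_fields (Entry Γ)
    obtain ⟨r, -, -, hN, -⟩ := exists_formal_ne_zero hG₁ hG₂ hne hP K L
    exact absurd (by simp [expSum]) hN
  obtain ⟨q₀, hq₀⟩ := uniformProb_pass_le hk d w
  obtain ⟨M, hM⟩ : ∃ M, 2 ^ (4 * k) ≤ M := ⟨_, le_rfl⟩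
  refine ⟨q₀ + M, fun Γ Δ G₁ G₂ hG₁ hG₂ e hne k' P hP hPb => ⟨?_, fun h₁ h₂ => ?_⟩⟩
  · intro p q _ _ hpq hq δ hδ hδ1 T hT
    have hle := hq₀ Γ Δ G₁ G₂ hG₁ hG₂ e hne k' P hP hPb p q hpq (by omega)
    have hmain := uniformProb_forall T (Set.univ : Set (Sample p q Γ))
      {s | Admissible G₁ G₂ s ∧ PassesTest G₁ G₂ s}
    simp only [Set.mem_univ, implies_true, Set.mem_ofPred_eq, forall_and, Set.ofPred_true]
      at hmain
    refine hmain.le.trans (pow_le_of_number_of_tests hk (Fact.out : q.Prime).one_lt hδ hδ1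
      (uniformProb_nonneg _ _) ?_ hT)
    have h2 := rpow_neg_half_le hk (q := q) (by omega)
    have h3 : (0 : ℝ) ≤ (q : ℝ) ^ (-(1 / (2 * k)) : ℝ) := by positivity
    linarith
  · obtain ⟨q₁, hq₁⟩ := eventually_admissible hG₁ hG₂ h₁ h₂ (1 / 2) (by norm_num)
    refine ⟨q₀ + M + q₁, fun p q _ _ hpq hq => ?_⟩
    have hinadm : uniformProb Set.univ {s : Sample p q Γ | ¬ Admissible G₁ G₂ s} ≤ 1 / 2 :=
      hq₁ p q hpq (by omega)
    have hcard : (0 : ℝ) < Nat.card (Sample p q Γ) := by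
      have : Nonempty (Sample p q Γ) := ⟨⟨0, 0, 1, one_pow q⟩⟩
      exact_mod_cast Nat.card_pos
    set A : Set (Sample p q Γ) := {s | Admissible G₁ G₂ s}
    have hA : (1 : ℝ) / 2 ≤ uniformProb Set.univ A := by
      have h1 : Set.univ = {s : Sample p q Γ | ¬ Admissible G₁ G₂ s} ∪ A := by
        ext s
        simp [A, em']
      have h2 := uniformProb_univ_union_le {s : Sample p q Γ | ¬ Admissible G₁ G₂ s} A
      rw [← h1, uniformProb_univ, Set.ncard_univ, div_self hcard.ne'] at h2
      linarith
    have hA0 : (0 : ℝ) < A.ncard := by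
      rw [uniformProb_univ, le_div_iff₀ hcard] at hA
      linarith
    refine ⟨?_, fun δ hδ hδ1 T hT => ?_⟩
    · have : A.ncard ≠ 0 := by exact_mod_cast hA0.ne'
      exact Set.nonempty_of_ncard_ne_zero this
    · refine (uniformProb_forall T A {s | PassesTest G₁ G₂ s}).le.trans
        (pow_le_of_number_of_tests hk (Fact.out : q.Prime).one_lt hδ hδ1
          (uniformProb_nonneg _ _) ?_ hT)
      have hle := hq₀ Γ Δ G₁ G₂ hG₁ hG₂ e hne k' P hP hPb p q hpq (by omega)
      refine le_trans ?_ (rpow_neg_half_le hk (q := q) (by omega))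
      -- Conditioning on an event of probability at least one half at most doubles a probability.
      rw [uniformProb_univ, le_div_iff₀ hcard] at hA
      rw [uniformProb_univ, div_le_iff₀ hcard] at hle
      rw [uniformProb, div_le_iff₀ hA0]
      have h3 : (0 : ℝ) ≤ (q : ℝ) ^ (-(1 / (2 * k)) : ℝ) := by positivity
      refine hle.trans ?_
      nlinarith
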